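/- **Setting.** Let $M,d,k$ be integers with $1\le k\le d$, let $n_1,\dots,n_M\ge 2$ be integers and $N=\sum_{i=1}^M n_i$. For $i\in[M]$ and $j\in[n_i]$ let $(x_{ij},y_{ij})\in\mathbb R^d\times\mathbb R$ be mutually independent samples with $\mathbb E[y_{ij}\mid x_{ij}]=x_{ij}^\top\theta_i^\star$, where $\theta_i^\star\in\mathbb R^d$, and put $\xi_{ij}=y_{ij}-x_{ij}^\top\theta_i^\star$. A random variable $X$ is called sub-gaussian with variance proxy $v$ if $\mathbb E\exp(t(X-\mathbb EX))\le\exp(vt^2/2)$ for all $t\in\mathbb R$, and a random vector is so if its inner product with every unit vector is. For a real symmetric matrix $S$, $\lambda_r(S)$ denotes its $r$-th largest eigenvalue. Fix constants $\sigma^2,\gamma^2\ge0$, $\kappa,A,c_2\in\mathbb R$ and $c_0,c_1>0$, and assume: 1. $\xi_{ij}$ is independent of $x_{ij}$, has mean zero and is sub-gaussian with variance proxy $\sigma^2$. 2. $x_{ij}$ has mean zero, is sub-gaussian with variance proxy $\gamma^2$, and $\mathbb E[x_{ij}x_{ij}^\top]=\Gamma_i$ does not depend on $j$. Moreover $\lambda_1(\Gamma_i)\le\kappa\,\lambda_d(\Gamma_i)$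 and $\lambda_1(\Gamma_i)\ge c_0$ for all $i$. 3. There are $B^\star\in\mathbb R^{d\times k}$ with orthonormal columns and $\alpha_i^\star\in\mathbb R^k$ such that $\Gamma_i\theta_i^\star=B^\star\alpha_i^\star$ for all $i$. 4. $\|\alpha_i^\star\|\le A$ for all $i$. 5. (Well-represented case.) The eigenvalues $\lambda_1\ge\dots\ge\lambda_k$ of the client diversity matrix $D=\frac1N\sum_{i=1}^M n_i\alpha_i^\star(\alpha_i^\star)^\top$ satisfy $\frac{c_1}{k}\le\lambda_k\le\lambda_1\le\frac{c_2}{k}$; that is, $\lambda_1=\Theta(\lambda_k)=\Theta(1/k)$. **Estimator.** Let $\overline z_i$ be the average of $y_{ij}x_{ij}$ over the first $\lfloor n_i/2\rfloor$ samples of client $i$, and $\widetilde z_i$ the average over its other samples (for even $n_i$: $\overline z_i=\frac2{n_i}\sum_{j\le n_i/2}y_{ij}x_{ij}$ and $\widetilde z_i=\frac2{n_i}\sum_{j>n_i/2}y_{ij}x_{ij}$). Let $Z=\sum_{i=1}^M n_i\,\overline z_i\widetilde z_i^\top$, and let $\widehat B\in\mathbb R^{d\times k}$ be formed by orthonormal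 top-$k$ right (or left) singular vectors of $Z$, with ties broken arbitrarily. **Claim.** There are constants $C_1,C_2>0$, depending only on $\sigma^2,\gamma^2,\kappa,c_0,A,c_1,c_2$, such that in every such setting, with probability at least $1-C_2(d+N)^{-10}$, $$\|\sin\Theta(\widehat B,B^\star)\|:=\big\|\widehat B\widehat B^\top-B^\star(B^\star)^\top\big\|\le C_1\left(\sqrt{\frac{dk}{N}}+\sqrt{\frac{Mdk^2}{N^2}}\right)\log^3(d+N),$$ where $\|\cdot\|$ on matrices is the spectral norm. -/

import Mathlib

open MeasureTheory ProbabilityTheory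
open scoped NNReal ENNReal Matrix

noncomputable section

namespace SharedRep

/-! ### Linear algebra -/

/-- `eigenvalueDesc A r` is `λ_r(A)`, the `r`-th largest eigenvalue (with multiplicity, `1 ≤ r ≤ m`)
of a real symmetric `m × m` matrix `A`. Outside this range the value is `0` and is never used. -/
def eigenvalueDesc {m : ℕ} (A : Matrix (Fin m) (Fin m) ℝ) (r : ℕ) : ℝ :=
  if h : A.IsHermitian ∧ 1 ≤ r ∧ r ≤ m then
    h.1.eigenvalues₀ ⟨r - 1, by rw [Fintype.card_fin]; omega⟩
  else 0

/-- `B ∈ 𝒪^{d × k}`: the columns of `B` are orthonormal. -/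
def IsOrthonormalMatrix {d k : ℕ} (B : Matrix (Fin d) (Fin k) ℝ) : Prop :=
  Bᵀ * B = 1

/-- The spectral norm of a square real matrix. -/
def spectralNorm {d : ℕ} (A : Matrix (Fin d) (Fin d) ℝ) : ℝ :=
  ‖Matrix.toEuclideanCLM (𝕜 := ℝ) (n := Fin d) A‖

/-- The principal angle distance `‖sin Θ(B, B')‖ = ‖B Bᵀ - B' B'ᵀ‖`. -/
def sinThetaDist {d k : ℕ} (B B' : Matrix (Fin d) (Fin k) ℝ) : ℝ :=
  spectralNorm (B * Bᵀ - B' * B'ᵀ)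

/-- The columns of `B` are top-`k` right singular vectors of `Z`: they are orthonormal, and the
`r`-th column `v` satisfies `Zᵀ Z v = σ_r² v` with `σ_r` the `r`-th largest singular value of `Z`
(Mathlib numbers the singular values from `0`). When singular values coincide, or vanish, `B` is
not determined by `Z`, and every choice is admitted. -/
def IsTopRightSingularVectors {d k : ℕ} (Z : Matrix (Fin d) (Fin d) ℝ)
    (B : Matrix (Fin d) (Fin k) ℝ) : Prop :=
  IsOrthonormalMatrix B ∧
    ∀ r : Fin k, (Zᵀ * Z) *ᵥ B.col r =
      ((Matrix.toEuclideanLin Z).singularValues (r : ℕ) : ℝ) ^ 2 • B.col r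

/-- Left singular vectors of `Z` are right singular vectors of `Zᵀ`. -/
def IsTopLeftSingularVectors {d k : ℕ} (Z : Matrix (Fin d) (Fin d) ℝ)
    (B : Matrix (Fin d) (Fin k) ℝ) : Prop :=
  IsTopRightSingularVectors Zᵀ B

/-! ### Parameters of the model -/

/-- The total number of samples `N = ∑ i, n_i`. -/
def totalSamples {M : ℕ} (n : Fin M → ℕ) : ℕ := ∑ i, n i

/-- The client diversity matrix `D = N⁻¹ ∑ i, n_i α_i α_iᵀ`. -/
def diversityMatrix {M k : ℕ} (n : Fin M → ℕ) (α : Fin M → EuclideanSpace ℝ (Fin k)) :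
    Matrix (Fin k) (Fin k) ℝ :=
  (totalSamples n : ℝ)⁻¹ • ∑ i, (n i : ℝ) • Matrix.vecMulVec (α i).ofLp (α i).ofLp

/-- `k`-dimensional structure: `B` has orthonormal columns and `Γ_i θ_i = B α_i` for every client. -/
structure LowDimStructure {M d k : ℕ} (Γ : Fin M → Matrix (Fin d) (Fin d) ℝ)
    (θ : Fin M → EuclideanSpace ℝ (Fin d)) (B : Matrix (Fin d) (Fin k) ℝ)
    (α : Fin M → EuclideanSpace ℝ (Fin k)) : Prop where
  orthonormal : IsOrthonormalMatrix B
  factor : ∀ i, Γ i *ᵥ (θ i).ofLp = B *ᵥ (α i).ofLp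

/-! ### The data and the assumptions on its distribution -/

section Data

variable {Ω : Type*} [MeasurableSpace Ω]

/-- `X` is sub-gaussian with variance proxy `v`: `𝔼 exp (t (X - 𝔼 X)) ≤ exp (v t² / 2)` for all `t`
(including integrability of the left-hand side). -/
def IsSubGaussian (μ : Measure Ω) (X : Ω → ℝ) (v : ℝ≥0) : Prop :=
  HasSubgaussianMGF (fun ω => X ω - ∫ ω', X ω' ∂μ) v μ

/-- A random vector is sub-gaussian with variance proxy `v` if all its projections on unit vectors
are. -/
def IsSubGaussianVector {d : ℕ} (μ : Measure Ω) (X : Ω → EuclideanSpace ℝ (Fin d)) (v : ℝ≥0) :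
    Prop :=
  ∀ u : EuclideanSpace ℝ (Fin d), ‖u‖ = 1 → IsSubGaussian μ (fun ω => inner ℝ u (X ω)) v

/-- The matrix `𝔼[X Xᵀ]`. -/
def secondMoment {d : ℕ} (μ : Measure Ω) (X : Ω → EuclideanSpace ℝ (Fin d)) :
    Matrix (Fin d) (Fin d) ℝ :=
  Matrix.of fun a b => ∫ ω, X ω a * X ω b ∂μ

variable {M d : ℕ} {n : Fin M → ℕ}

/-- The noise `ξ_{ij} = y_{ij} - x_{ij}ᵀ θ_i`; it is `y_{ij} - 𝔼[y_{ij} | x_{ij}]` under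
`IsLinearModel`. -/
def noise (x : (i : Fin M) → Fin (n i) → Ω → EuclideanSpace ℝ (Fin d))
    (y : (i : Fin M) → Fin (n i) → Ω → ℝ) (θ : Fin M → EuclideanSpace ℝ (Fin d))
    (i : Fin M) (j : Fin (n i)) (ω : Ω) : ℝ :=
  y i j ω - inner ℝ (x i j ω) (θ i)

/-- The samples `(x_{ij}, y_{ij})` are mutually independent over all `i` and `j`, and
`𝔼[y_{ij} | x_{ij}] = x_{ij}ᵀ θ_i`. -/
structure IsLinearModel (μ : Measure Ω)
    (x : (i : Fin M) → Fin (n i) → Ω → EuclideanSpace ℝ (Fin d))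
    (y : (i : Fin M) → Fin (n i) → Ω → ℝ) (θ : Fin M → EuclideanSpace ℝ (Fin d)) : Prop where
  measurable_x : ∀ i j, Measurable (x i j)
  measurable_y : ∀ i j, Measurable (y i j)
  indep : iIndepFun (fun (p : (i : Fin M) × Fin (n i)) ω => (x p.1 p.2 ω, y p.1 p.2 ω)) μ
  regression : ∀ i j,
    μ[y i j | MeasurableSpace.comap (x i j) inferInstance] =ᵐ[μ] fun ω => inner ℝ (x i j ω) (θ i)

/-- Zero-mean sub-gaussian noise with variance proxy `σ2`, independent of the covariates. Together
with the independence of the samples this says that the `ξ_{ij}` are mutually independent and that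
the family `(ξ_{ij})` is independent of the family `(x_{ij})`. -/
structure SubGaussianNoise (μ : Measure Ω)
    (x : (i : Fin M) → Fin (n i) → Ω → EuclideanSpace ℝ (Fin d))
    (y : (i : Fin M) → Fin (n i) → Ω → ℝ) (θ : Fin M → EuclideanSpace ℝ (Fin d)) (σ2 : ℝ≥0) :
    Prop where
  indep_covariate : ∀ i j, IndepFun (noise x y θ i j) (x i j) μ
  mean_zero : ∀ i j, ∫ ω, noise x y θ i j ω ∂μ = 0
  subGaussian : ∀ i j, IsSubGaussian μ (noise x y θ i j) σ2

/-- Zero-mean sub-gaussian covariates with variance proxy `γ2`, whose covariance `Γ_i` is the same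
for all samples of client `i`. Its condition number is at most `κ` (written without division) and
its largest eigenvalue is at least `c₀`; as `λ_1(Γ_i) ≤ γ2` always holds, all the eigenvalues of
`Γ_i` are of constant order. Independence is part of `IsLinearModel`. -/
structure SubGaussianCovariates (μ : Measure Ω)
    (x : (i : Fin M) → Fin (n i) → Ω → EuclideanSpace ℝ (Fin d))
    (Γ : Fin M → Matrix (Fin d) (Fin d) ℝ) (γ2 : ℝ≥0) (κ c₀ : ℝ) : Prop where
  mean_zero : ∀ i j, ∫ ω, x i j ω ∂μ = 0
  subGaussian : ∀ i j, IsSubGaussianVector μ (x i j) γ2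
  covariance : ∀ i j, secondMoment μ (x i j) = Γ i
  condition_number : ∀ i, eigenvalueDesc (Γ i) 1 ≤ κ * eigenvalueDesc (Γ i) d
  scale : ∀ i, c₀ ≤ eigenvalueDesc (Γ i) 1

end Data

/-! ### The estimator -/

/-- The average of `y_j x_j` over the first `⌊m/2⌋` of the `m` samples of a client. -/
def firstHalfMean {d m : ℕ} (x : Fin m → EuclideanSpace ℝ (Fin d)) (y : Fin m → ℝ) :
    EuclideanSpace ℝ (Fin d) :=
  ((m / 2 : ℕ) : ℝ)⁻¹ • ∑ j ∈ Finset.univ.filter (fun j : Fin m => (j : ℕ) < m / 2), y j • x j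

/-- The average of `y_j x_j` over the other `m - ⌊m/2⌋` samples of a client. For even `m` both
averages are `(2/m) ∑ y_j x_j` over one half of the samples. -/
def secondHalfMean {d m : ℕ} (x : Fin m → EuclideanSpace ℝ (Fin d)) (y : Fin m → ℝ) :
    EuclideanSpace ℝ (Fin d) :=
  ((m - m / 2 : ℕ) : ℝ)⁻¹ • ∑ j ∈ Finset.univ.filter (fun j : Fin m => m / 2 ≤ (j : ℕ)), y j • x j

/-- The matrix `Z = ∑ i, n_i z̄_i z̃_iᵀ`. -/
def estimatorMatrix {M d : ℕ} {n : Fin M → ℕ}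
    (x : (i : Fin M) → Fin (n i) → EuclideanSpace ℝ (Fin d)) (y : (i : Fin M) → Fin (n i) → ℝ) :
    Matrix (Fin d) (Fin d) ℝ :=
  ∑ i, (n i : ℝ) • Matrix.vecMulVec (firstHalfMean (x i) (y i)).ofLp
    (secondHalfMean (x i) (y i)).ofLp

/-- `Bhat` is a value of the estimator on the data `(x, y)`: it is formed by the top-`k` right, or
left, singular vectors of `Z`. -/
def IsEstimate {M d k : ℕ} {n : Fin M → ℕ}
    (x : (i : Fin M) → Fin (n i) → EuclideanSpace ℝ (Fin d)) (y : (i : Fin M) → Fin (n i) → ℝ)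
    (Bhat : Matrix (Fin d) (Fin k) ℝ) : Prop :=
  IsTopRightSingularVectors (estimatorMatrix x y) Bhat ∨
    IsTopLeftSingularVectors (estimatorMatrix x y) Bhat

/-- The error rate `(√(dk/N) + √(Mdk²/N²)) log³(d + N)`. -/
def errorRate (d k M N : ℕ) : ℝ :=
  (√((d : ℝ) * k / N) + √((M : ℝ) * d * (k : ℝ) ^ 2 / (N : ℝ) ^ 2)) *
    Real.log ((d : ℝ) + N) ^ 3

end SharedRep

end

namespace SharedRep

/-! ### Perturbation of singular subspaces -/

section LinearAlgebra

open Module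
open scoped RealInnerProductSpace

variable {E F : Type*} [NormedAddCommGroup E] [InnerProductSpace ℝ E]
  [NormedAddCommGroup F] [InnerProductSpace ℝ F]

/-! The noise drops out of `E[y x]`, so every client satisfies `E[y x] = Γ θ = B α`. The two
half-sample averages of a client are independent, so `Z` has mean `∑ n_i (B α_i)(B α_i)ᵀ = B (N D)
Bᵀ`, with no bias from squared noise. This mean has rank `k`, range in that of `B`, and smallest
nonzero singular value at least `N c₁ / k`. A Wedin-type argument (`sinThetaDist_right_le`,
`sinThetaDist_left_le`) then bounds the error by a constant times `‖Z - B (N D) Bᵀ‖ / (N / k)`.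

The deviation of `Z` is controlled after truncating the responses at `L ≍ log (d + N)`. With high
probability truncation changes nothing, its bias is of order `exp (-L)` (`truncation_bias_le`), and
the truncated `y x` is sub-gaussian with proxy of order `L²`. For unit vectors `u, v`, the form `⟪u,
(Z - B (N D) Bᵀ) v⟫` splits into three random sums and a deterministic bias (`measure_form_ge_le`).
The product of the two centered averages is sub-exponential, and Bernstein's inequality gives `√(M
τ) + τ` (`measure_bilinear_ge_le`). The two linear terms are sub-gaussian with variance of order `N
/ k`, because `λ₁ ≤ c₂ / k` (`sum_inner_sq_le`, `measure_linear_ge_le`).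

A union bound over pairs from a `1/2`-net of the sphere costs `25 ^ d`, which is why `τ` is of order
`d + log (d + N)`. Up to logarithms the deviation is `√(M d) + d + √(d N / k)`. After division by `N
/ k` the outer terms are the two terms of the rate, and the middle one is absorbed when `d k ≤ N`.
If `d k > N`, the rate is at least `1` and the claim is trivial, since the distance never exceeds
`2`. -/

lemma norm_of_left_inverse {J : F →ₗ[ℝ] E} {J' : E →ₗ[ℝ] F}
    (hadj : ∀ x e, ⟪J x, e⟫ = ⟪x, J' e⟫) (hinv : ∀ x, J' (J x) = x) (x : F) : ‖J x‖ = ‖x‖ := by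
  have h : ‖J x‖ ^ 2 = ‖x‖ ^ 2 := by
    rw [← real_inner_self_eq_norm_sq, hadj, hinv, real_inner_self_eq_norm_sq]
  exact (sq_eq_sq₀ (norm_nonneg _) (norm_nonneg _)).1 h

/-- Pythagoras. Subspaces are encoded by an isometry `J` with adjoint `J'`, so that `J ∘ J'` is the
orthogonal projection onto the range of `J`. -/
lemma norm_sub_proj_sq {J : F →ₗ[ℝ] E} {J' : E →ₗ[ℝ] F}
    (hadj : ∀ x e, ⟪J x, e⟫ = ⟪x, J' e⟫) (hinv : ∀ x, J' (J x) = x) (e : E) :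
    ‖e - J (J' e)‖ ^ 2 = ‖e‖ ^ 2 - ‖J' e‖ ^ 2 := by
  rw [norm_sub_sq_real, real_inner_comm, hadj, norm_of_left_inverse hadj hinv,
    real_inner_self_eq_norm_sq]
  ring

lemma norm_proj_le {J : F →ₗ[ℝ] E} {J' : E →ₗ[ℝ] F}
    (hadj : ∀ x e, ⟪J x, e⟫ = ⟪x, J' e⟫) (hinv : ∀ x, J' (J x) = x) (e : E) : ‖J' e‖ ≤ ‖e‖ := by
  have h := norm_sub_proj_sq hadj hinv e
  nlinarith [norm_nonneg e, norm_nonneg (J' e), sq_nonneg ‖e - J (J' e)‖]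

lemma norm_sub_proj_le {J : F →ₗ[ℝ] E} {J' : E →ₗ[ℝ] F}
    (hadj : ∀ x e, ⟪J x, e⟫ = ⟪x, J' e⟫) (hinv : ∀ x, J' (J x) = x) (e : E) :
    ‖e - J (J' e)‖ ≤ ‖e‖ := by
  have h := norm_sub_proj_sq hadj hinv e
  nlinarith [norm_nonneg e, norm_nonneg (e - J (J' e)), sq_nonneg ‖J' e‖]

/-- For subspaces of the same dimension the gap is symmetric. -/
lemma gap_symm [FiniteDimensional ℝ F] {J W : F →ₗ[ℝ] E} {J' W' : E →ₗ[ℝ] F}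
    (hJ : ∀ x e, ⟪J x, e⟫ = ⟪x, J' e⟫) (hJJ : ∀ x, J' (J x) = x)
    (hW : ∀ x e, ⟪W x, e⟫ = ⟪x, W' e⟫) (hWW : ∀ x, W' (W x) = x)
    {s : ℝ} (hs : 0 ≤ s) (h : ∀ x, ‖W x - J (J' (W x))‖ ≤ s * ‖x‖) (y : F) :
    ‖J y - W (W' (J y))‖ ≤ s * ‖y‖ := by
  rcases le_or_gt 1 s with h1 | h1
  · calc _ ≤ ‖J y‖ := norm_sub_proj_le hW hWW _
      _ = ‖y‖ := norm_of_left_inverse hJ hJJ y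
      _ ≤ s * ‖y‖ := le_mul_of_one_le_left (norm_nonneg _) h1
  have hc : 0 < 1 - s ^ 2 := by nlinarith
  have hA : ∀ x, (1 - s ^ 2) * ‖x‖ ^ 2 ≤ ‖J' (W x)‖ ^ 2 := fun x => by
    have h2 := norm_sub_proj_sq hJ hJJ (W x)
    rw [norm_of_left_inverse hW hWW] at h2
    have h3 := pow_le_pow_left₀ (norm_nonneg _) (h x) 2
    nlinarith
  -- Equal dimension enters here: an injective endomorphism of `F` is surjective, so `y = J' (W x)`
  -- with `‖x‖` controlled by `hA`. Pairing `y` with itself then bounds `‖W' (J y)‖` from below.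
  have hinj : Function.Injective (J' ∘ₗ W) := by
    rw [injective_iff_map_eq_zero]
    intro x hx
    have h2 := hA x
    rw [show J' (W x) = 0 from hx, norm_zero] at h2
    have : ‖x‖ ^ 2 ≤ 0 := by nlinarith [sq_nonneg ‖x‖]
    exact norm_eq_zero.1 (pow_eq_zero_iff two_ne_zero |>.1 (le_antisymm this (sq_nonneg _)))
  obtain ⟨x, hx⟩ := (LinearMap.injective_iff_surjective.1 hinj) y
  have hx' : J' (W x) = y := hx
  have h4 : ‖y‖ ^ 2 ≤ ‖x‖ * ‖W' (J y)‖ := by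
    calc ‖y‖ ^ 2 = ⟪y, J' (W x)⟫ := by rw [hx', real_inner_self_eq_norm_sq]
      _ = ⟪x, W' (J y)⟫ := by rw [← hJ, real_inner_comm, hW]
      _ ≤ _ := real_inner_le_norm _ _
  have h5 := hA x
  rw [hx'] at h5
  have h6 : (1 - s ^ 2) * ‖y‖ ^ 2 ≤ ‖W' (J y)‖ ^ 2 := by
    rcases eq_or_lt_of_le (norm_nonneg y) with h0 | h0
    · rw [← h0]; simp
    · have h7 : (‖y‖ ^ 2) ^ 2 ≤ ‖x‖ ^ 2 * ‖W' (J y)‖ ^ 2 := by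
        rw [← mul_pow]; exact pow_le_pow_left₀ (sq_nonneg _) h4 2
      have h8 : (1 - s ^ 2) * (‖y‖ ^ 2) ^ 2 ≤ ‖y‖ ^ 2 * ‖W' (J y)‖ ^ 2 := by
        calc _ ≤ (1 - s ^ 2) * (‖x‖ ^ 2 * ‖W' (J y)‖ ^ 2) := by gcongr
          _ = ((1 - s ^ 2) * ‖x‖ ^ 2) * ‖W' (J y)‖ ^ 2 := by ring
          _ ≤ _ := by gcongr
      have h9 : 0 < ‖y‖ ^ 2 := by positivity
      nlinarith
  have h7 := norm_sub_proj_sq hW hWW (J y)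
  rw [norm_of_left_inverse hJ hJJ] at h7
  refine abs_le_of_sq_le_sq' ?_ (by positivity) |>.2
  nlinarith

/-- Split `e` into its part in the range of `W`, where the gap hypothesis applies directly, and the
orthogonal part `q`, where the reversed gap `gap_symm` applies. Each contributes `s * ‖e‖`. -/
lemma norm_proj_sub_proj_le [FiniteDimensional ℝ F] {J W : F →ₗ[ℝ] E} {J' W' : E →ₗ[ℝ] F}
    (hJ : ∀ x e, ⟪J x, e⟫ = ⟪x, J' e⟫) (hJJ : ∀ x, J' (J x) = x)
    (hW : ∀ x e, ⟪W x, e⟫ = ⟪x, W' e⟫) (hWW : ∀ x, W' (W x) = x)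
    {s : ℝ} (hs : 0 ≤ s) (h : ∀ x, ‖W x - J (J' (W x))‖ ≤ s * ‖x‖) (e : E) :
    ‖W (W' e) - J (J' e)‖ ≤ 2 * s * ‖e‖ := by
  set q := e - W (W' e) with hq
  have h1 : ‖J' q‖ ≤ s * ‖e‖ := by
    have h2 : ‖J' q‖ ^ 2 ≤ s * ‖e‖ * ‖J' q‖ := by
      have hqq : ∀ f, ⟪q, W f⟫ = 0 := fun f => by
        rw [hq, inner_sub_left, real_inner_comm, hW, hW, hWW, real_inner_comm, sub_self]
      calc ‖J' q‖ ^ 2 = ⟪q, J (J' q)⟫ := by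
            rw [real_inner_comm, hJ, real_inner_self_eq_norm_sq]
        _ = ⟪q, J (J' q) - W (W' (J (J' q)))⟫ := by rw [inner_sub_right, hqq, sub_zero]
        _ ≤ ‖q‖ * ‖J (J' q) - W (W' (J (J' q)))‖ := real_inner_le_norm _ _
        _ ≤ ‖e‖ * (s * ‖J' q‖) := by
            gcongr
            · exact norm_sub_proj_le hW hWW e
            · exact gap_symm hJ hJJ hW hWW hs h _
        _ = _ := by ring
    rcases eq_or_lt_of_le (norm_nonneg (J' q)) with h0 | h0
    · rw [← h0]; positivity
    · nlinarith
  have h2 : W (W' e) - J (J' e) = (W (W' e) - J (J' (W (W' e)))) - J (J' q) := by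
    simp only [hq, map_sub]; abel
  rw [h2]
  calc _ ≤ ‖W (W' e) - J (J' (W (W' e)))‖ + ‖J (J' q)‖ := norm_sub_le _ _
    _ ≤ s * ‖e‖ + s * ‖e‖ := by
        gcongr
        · exact (h _).trans (by gcongr; exact norm_proj_le hW hWW e)
        · rwa [norm_of_left_inverse hJ hJJ]
    _ = _ := by ring

/-- One half of Courant–Fischer. By counting dimensions, some `y ≠ 0` has `J y` orthogonal to the
`r` leading eigenvectors of `T* T`, and there `T` expands by at most its singular value of
(zero-based) index `r`. -/
lemma le_singularValues [FiniteDimensional ℝ E] [FiniteDimensional ℝ F] (T : E →ₗ[ℝ] E)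
    {J : F →ₗ[ℝ] E} (hJ : ∀ y, ‖J y‖ = ‖y‖) {c : ℝ} (hc : ∀ y, c * ‖y‖ ≤ ‖T (J y)‖) {r : ℕ}
    (hr : r < finrank ℝ F) : c ≤ T.singularValues r := by
  rcases le_or_gt c 0 with hc0 | hc0
  · exact hc0.trans (T.singularValues_nonneg r)
  have hinj : Function.Injective J := by
    rw [injective_iff_map_eq_zero]
    intro x hx
    rw [← norm_eq_zero, ← hJ, hx, norm_zero]
  have hrE : r < finrank ℝ E := hr.trans_le (LinearMap.finrank_le_finrank_of_injective hinj)
  have hS := T.isSymmetric_adjoint_comp_self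
  let b := hS.eigenvectorBasis rfl
  let φ : F →ₗ[ℝ] (Fin r → ℝ) := LinearMap.pi fun j =>
    (innerₛₗ ℝ (b ⟨j, j.2.trans hrE⟩)) ∘ₗ J
  have hker : LinearMap.ker φ ≠ ⊥ := LinearMap.ker_ne_bot_of_finrank_lt (by simpa using hr)
  obtain ⟨y, hy, hy0⟩ := (Submodule.ne_bot_iff _).1 hker
  have hφ : ∀ j : Fin (finrank ℝ E), (j : ℕ) < r → ⟪b j, J y⟫ = 0 := fun j hj => by
    have := congrFun (LinearMap.mem_ker.1 hy) ⟨j, hj⟩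
    simpa [φ] using this
  have hsum : ‖T (J y)‖ ^ 2 = ∑ j, hS.eigenvalues rfl j * ⟪b j, J y⟫ ^ 2 := by
    rw [← real_inner_self_eq_norm_sq, ← LinearMap.adjoint_inner_left,
      ← b.sum_inner_mul_inner]
    refine Finset.sum_congr rfl fun j _ => ?_
    have h1 : ⟪LinearMap.adjoint T (T (J y)), b j⟫ = hS.eigenvalues rfl j * ⟪b j, J y⟫ := by
      have := hS (J y) (b j)
      rw [hS.apply_eigenvectorBasis rfl j] at this
      simp only [LinearMap.comp_apply, inner_smul_right] at this
      rw [this, real_inner_comm]; rfl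
    rw [h1]; ring
  have hle : ‖T (J y)‖ ^ 2 ≤ T.singularValues r ^ 2 * ‖J y‖ ^ 2 := by
    rw [hsum, ← b.sum_sq_norm_inner_right, Finset.mul_sum]
    refine Finset.sum_le_sum fun j _ => ?_
    rcases lt_or_ge (j : ℕ) r with hj | hj
    · rw [hφ j hj]; simp
    · rw [Real.norm_eq_abs, sq_abs, ← T.sq_singularValues_fin rfl]
      gcongr
      · exact T.singularValues_nonneg _
      · exact T.singularValues_antitone hj
  have h1 := hc y
  have hy1 : 0 < ‖y‖ := norm_pos_iff.2 hy0
  rw [hJ] at hle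
  have h2 : (c * ‖y‖) ^ 2 ≤ (T.singularValues r * ‖y‖) ^ 2 := by
    rw [mul_pow (T.singularValues r : ℝ)]
    exact (pow_le_pow_left₀ (by positivity) h1 2).trans hle
  have h3 := abs_le_of_sq_le_sq' h2 (mul_nonneg (T.singularValues_nonneg r) hy1.le) |>.2
  exact le_of_mul_le_mul_right h3 hy1

/-- Dividing by the squared singular values writes `W x` as `T' w` with `‖w‖ ≤ ‖x‖ / δ`. Since `T'`
is `η`-close to an operator with values in the range of `J`, so is `W x` to that range, at scale `η
/ δ`. Of the approximating operator only its range matters. -/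
lemma gap_of_singular_vectors {ι : Type*} [Fintype ι] {T T' : E →ₗ[ℝ] E}
    {W : EuclideanSpace ℝ ι →ₗ[ℝ] E} {W' : E →ₗ[ℝ] EuclideanSpace ℝ ι}
    {J : F →ₗ[ℝ] E} {J' : E →ₗ[ℝ] F} {G' : F →ₗ[ℝ] F}
    (hT : ∀ x y, ⟪T x, y⟫ = ⟪x, T' y⟫)
    (hW : ∀ x e, ⟪W x, e⟫ = ⟪x, W' e⟫) (hWW : ∀ x, W' (W x) = x)
    (hJ : ∀ x e, ⟪J x, e⟫ = ⟪x, J' e⟫) (hJJ : ∀ x, J' (J x) = x)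
    {η δ : ℝ} (hη : 0 ≤ η) (hδ : 0 < δ) (hpert : ∀ e, ‖T' e - J (G' (J' e))‖ ≤ η * ‖e‖)
    {σ : ι → ℝ} (hσ : ∀ r, δ ≤ σ r)
    (hsing : ∀ x y : EuclideanSpace ℝ ι, (∀ r, x r = σ r ^ 2 * y r) → T' (T (W y)) = W x)
    (x : EuclideanSpace ℝ ι) : ‖W x - J (J' (W x))‖ ≤ η / δ * ‖x‖ := by
  have hσ0 : ∀ r, 0 < σ r := fun r => hδ.trans_le (hσ r)
  let y : EuclideanSpace ℝ ι := WithLp.toLp 2 fun r => x r / σ r ^ 2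
  have hy : T' (T (W y)) = W x := hsing x y fun r => by
    simp only [y]; field_simp [(hσ0 r).ne']
  have h1 : ‖T (W y)‖ ≤ ‖x‖ / δ := by
    refine abs_le_of_sq_le_sq' ?_ (by positivity) |>.2
    rw [← real_inner_self_eq_norm_sq, hT, hy, hW, hWW, div_pow, EuclideanSpace.norm_sq_eq,
      PiLp.inner_apply, Finset.sum_div]
    refine Finset.sum_le_sum fun r _ => ?_
    simp only [y, RCLike.inner_apply, conj_trivial, Real.norm_eq_abs, sq_abs]
    rw [mul_div_assoc', ← sq]
    gcongr
    exact hσ r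
  set w := T (W y)
  have h2 : W x - J (J' (W x)) = (T' w - J (G' (J' w))) - J (J' (T' w - J (G' (J' w)))) := by
    rw [← hy]
    simp only [map_sub, hJJ]; abel
  rw [h2]
  calc _ ≤ ‖T' w - J (G' (J' w))‖ := norm_sub_proj_le hJ hJJ _
    _ ≤ η * (‖x‖ / δ) := (hpert w).trans (by gcongr)
    _ = _ := by ring

end LinearAlgebra

/-! ### Matrices as Euclidean operators, and the singular subspace bound -/

section Matrices

open scoped RealInnerProductSpace

variable {d k : ℕ}

lemma inner_toEuclideanLin_left {m n : ℕ} (A : Matrix (Fin m) (Fin n) ℝ)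
    (x : EuclideanSpace ℝ (Fin n)) (y : EuclideanSpace ℝ (Fin m)) :
    ⟪Matrix.toEuclideanLin A x, y⟫ = ⟪x, Matrix.toEuclideanLin Aᵀ y⟫ := by
  rw [← Matrix.conjTranspose_eq_transpose_of_trivial,
    Matrix.toEuclideanLin_conjTranspose_eq_adjoint, LinearMap.adjoint_inner_right]

lemma toEuclideanLin_mul_apply {l m n : ℕ} (A : Matrix (Fin l) (Fin m) ℝ)
    (B : Matrix (Fin m) (Fin n) ℝ) (x : EuclideanSpace ℝ (Fin n)) :
    Matrix.toEuclideanLin (A * B) x = Matrix.toEuclideanLin A (Matrix.toEuclideanLin B x) := by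
  ext i
  simp [Matrix.toLpLin_apply, Matrix.mulVec_mulVec]

lemma IsOrthonormalMatrix.left_inverse {B : Matrix (Fin d) (Fin k) ℝ} (hB : IsOrthonormalMatrix B)
    (x : EuclideanSpace ℝ (Fin k)) :
    Matrix.toEuclideanLin Bᵀ (Matrix.toEuclideanLin B x) = x := by
  rw [← toEuclideanLin_mul_apply, hB]
  ext i
  simp

lemma norm_toEuclideanLin_transpose_le {A : Matrix (Fin d) (Fin d) ℝ} {η : ℝ} (hη : 0 ≤ η)
    (h : ∀ x, ‖Matrix.toEuclideanLin A x‖ ≤ η * ‖x‖) (x : EuclideanSpace ℝ (Fin d)) :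
    ‖Matrix.toEuclideanLin Aᵀ x‖ ≤ η * ‖x‖ := by
  set w := Matrix.toEuclideanLin Aᵀ x with hw
  have h1 : ‖w‖ ^ 2 ≤ η * ‖x‖ * ‖w‖ := by
    calc ‖w‖ ^ 2 = ⟪Matrix.toEuclideanLin A w, x⟫ := by
          rw [inner_toEuclideanLin_left, ← hw, real_inner_self_eq_norm_sq]
      _ ≤ ‖Matrix.toEuclideanLin A w‖ * ‖x‖ := real_inner_le_norm _ _
      _ ≤ η * ‖w‖ * ‖x‖ := by gcongr; exact h w
      _ = _ := by ring
  rcases eq_or_lt_of_le (norm_nonneg w) with h0 | h0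
  · rw [← h0]; positivity
  · nlinarith

lemma sinThetaDist_le {B V : Matrix (Fin d) (Fin k) ℝ} (hB : IsOrthonormalMatrix B)
    (hV : IsOrthonormalMatrix V) {s : ℝ} (hs : 0 ≤ s)
    (h : ∀ x, ‖Matrix.toEuclideanLin V x - Matrix.toEuclideanLin B
      (Matrix.toEuclideanLin Bᵀ (Matrix.toEuclideanLin V x))‖ ≤ s * ‖x‖) :
    sinThetaDist V B ≤ 2 * s := by
  refine ContinuousLinearMap.opNorm_le_bound _ (by positivity) fun e => ?_
  have h1 : Matrix.toEuclideanCLM (𝕜 := ℝ) (n := Fin d) (V * Vᵀ - B * Bᵀ) e =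
      Matrix.toEuclideanLin V (Matrix.toEuclideanLin Vᵀ e) -
        Matrix.toEuclideanLin B (Matrix.toEuclideanLin Bᵀ e) := by
    rw [← toEuclideanLin_mul_apply, ← toEuclideanLin_mul_apply, ← LinearMap.sub_apply, ← map_sub]
    rfl
  rw [h1]
  exact norm_proj_sub_proj_le (inner_toEuclideanLin_left B) hB.left_inverse
    (inner_toEuclideanLin_left V) hV.left_inverse hs h e

lemma sinThetaDist_le_two {B V : Matrix (Fin d) (Fin k) ℝ} (hB : IsOrthonormalMatrix B)
    (hV : IsOrthonormalMatrix V) : sinThetaDist V B ≤ 2 := by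
  have h := sinThetaDist_le hB hV zero_le_one fun x => by
    rw [one_mul, ← norm_of_left_inverse (inner_toEuclideanLin_left V) hV.left_inverse x]
    exact norm_sub_proj_le (inner_toEuclideanLin_left B) hB.left_inverse _
  linarith

lemma toEuclideanLin_singular_vectors {Z : Matrix (Fin d) (Fin d) ℝ} {V : Matrix (Fin d) (Fin k) ℝ}
    (hV : IsTopRightSingularVectors Z V) (x y : EuclideanSpace ℝ (Fin k))
    (hxy : ∀ r : Fin k, x r = (Matrix.toEuclideanLin Z).singularValues (r : ℕ) ^ 2 * y r) :
    Matrix.toEuclideanLin Zᵀ (Matrix.toEuclideanLin Z (Matrix.toEuclideanLin V y)) =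
      Matrix.toEuclideanLin V x := by
  have key : ∀ z : Fin k → ℝ, V *ᵥ z = ∑ r, z r • V.col r := fun z => by
    ext i; simp [Matrix.mulVec, dotProduct, Matrix.col, mul_comm]
  rw [← toEuclideanLin_mul_apply]
  apply WithLp.ofLp_injective
  simp only [Matrix.toLpLin_apply]
  rw [key, key, Matrix.mulVec_sum]
  refine Finset.sum_congr rfl fun r _ => ?_
  rw [Matrix.mulVec_smul, hV.2 r, smul_smul, hxy r, mul_comm]

/-- Wedin's theorem for a matrix close to `B G Bᵀ` with `G` invertible. -/
theorem sinThetaDist_right_le {Z : Matrix (Fin d) (Fin d) ℝ} {B V : Matrix (Fin d) (Fin k) ℝ}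
    {G : Matrix (Fin k) (Fin k) ℝ} (hB : IsOrthonormalMatrix B)
    (hV : IsTopRightSingularVectors Z V) {η g : ℝ} (hη : 0 ≤ η) (hg : 0 < g)
    (hG : ∀ x, g * ‖x‖ ≤ ‖Matrix.toEuclideanLin G x‖)
    (hZ : ∀ x, ‖Matrix.toEuclideanLin (Z - B * G * Bᵀ) x‖ ≤ η * ‖x‖) :
    sinThetaDist V B ≤ 4 * η / g := by
  -- A perturbation of at least half the gap makes the bound at least `2`, which always holds.
  rcases le_or_gt (g / 2) η with h | h
  · refine (sinThetaDist_le_two hB hV.1).trans ?_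
    rw [le_div_iff₀ hg]; linarith
  have hJ := inner_toEuclideanLin_left B
  have hBn := norm_of_left_inverse hJ hB.left_inverse
  -- On the range of `B`, `Z` is bounded below by `g - η ≥ g / 2`; the min-max bound turns this into
  -- `k` large singular values.
  have hσ : ∀ r : Fin k, g / 2 ≤ (Matrix.toEuclideanLin Z).singularValues r := fun r => by
    refine le_singularValues (F := EuclideanSpace ℝ (Fin k)) _ hBn (fun y => ?_) (by simp)
    have h1 := hZ (Matrix.toEuclideanLin B y)
    rw [map_sub, LinearMap.sub_apply, toEuclideanLin_mul_apply, toEuclideanLin_mul_apply,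
      hB.left_inverse, hBn] at h1
    have h2 := norm_sub_norm_le (Matrix.toEuclideanLin B (Matrix.toEuclideanLin G y))
      (Matrix.toEuclideanLin Z (Matrix.toEuclideanLin B y))
    rw [norm_sub_rev, hBn] at h2
    have h3 := hG y
    nlinarith [norm_nonneg y]
  have hgap := gap_of_singular_vectors (T := Matrix.toEuclideanLin Z)
    (T' := Matrix.toEuclideanLin Zᵀ) (W := Matrix.toEuclideanLin V)
    (W' := Matrix.toEuclideanLin Vᵀ) (J := Matrix.toEuclideanLin B)
    (J' := Matrix.toEuclideanLin Bᵀ) (G' := Matrix.toEuclideanLin Gᵀ)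
    (inner_toEuclideanLin_left Z) (inner_toEuclideanLin_left V) hV.1.left_inverse hJ
    hB.left_inverse hη (half_pos hg) (fun e => ?_) hσ (toEuclideanLin_singular_vectors hV)
  · refine (sinThetaDist_le hB hV.1 (by positivity) hgap).trans (le_of_eq ?_)
    field_simp; ring
  · have h1 := norm_toEuclideanLin_transpose_le hη hZ e
    rwa [Matrix.transpose_sub, Matrix.transpose_mul, Matrix.transpose_mul,
      Matrix.transpose_transpose, ← Matrix.mul_assoc, map_sub, LinearMap.sub_apply,
      toEuclideanLin_mul_apply, toEuclideanLin_mul_apply] at h1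

/-- Transposition preserves both the operator bound and the symmetric signal `B G Bᵀ`, so the
right-hand case applies to `Zᵀ`. -/
theorem sinThetaDist_left_le {Z : Matrix (Fin d) (Fin d) ℝ} {B V : Matrix (Fin d) (Fin k) ℝ}
    {G : Matrix (Fin k) (Fin k) ℝ} (hB : IsOrthonormalMatrix B) (hsymm : Gᵀ = G)
    (hV : IsTopLeftSingularVectors Z V) {η g : ℝ} (hη : 0 ≤ η) (hg : 0 < g)
    (hG : ∀ x, g * ‖x‖ ≤ ‖Matrix.toEuclideanLin G x‖)
    (hZ : ∀ x, ‖Matrix.toEuclideanLin (Z - B * G * Bᵀ) x‖ ≤ η * ‖x‖) :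
    sinThetaDist V B ≤ 4 * η / g := by
  refine sinThetaDist_right_le hB hV hη hg hG fun x => ?_
  have h1 := norm_toEuclideanLin_transpose_le hη hZ x
  rwa [Matrix.transpose_sub, Matrix.transpose_mul, Matrix.transpose_mul,
      Matrix.transpose_transpose, ← Matrix.mul_assoc, hsymm] at h1

/-! ### Quadratic forms and extreme eigenvalues -/

lemma quadratic_form_eq {m : ℕ} {A : Matrix (Fin m) (Fin m) ℝ} (hA : A.IsHermitian)
    (x : EuclideanSpace ℝ (Fin m)) :
    ⟪x, Matrix.toEuclideanLin A x⟫ =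
      ∑ j, hA.eigenvalues j * ⟪hA.eigenvectorBasis j, x⟫ ^ 2 := by
  rw [← hA.eigenvectorBasis.sum_inner_mul_inner]
  refine Finset.sum_congr rfl fun j _ => ?_
  have h1 : ⟪hA.eigenvectorBasis j, Matrix.toEuclideanLin A x⟫ =
      hA.eigenvalues j * ⟪hA.eigenvectorBasis j, x⟫ := by
    have h2 : Matrix.toEuclideanLin A (hA.eigenvectorBasis j) =
        hA.eigenvalues j • hA.eigenvectorBasis j := by
      apply WithLp.ofLp_injective
      simpa [Matrix.toLpLin_apply] using hA.mulVec_eigenvectorBasis j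
    have h3 := inner_toEuclideanLin_left A (hA.eigenvectorBasis j) x
    rw [← Matrix.conjTranspose_eq_transpose_of_trivial, hA.eq, h2, inner_smul_left] at h3
    simpa using h3.symm
  rw [h1, real_inner_comm]; ring

lemma eigenvalueDesc_last_mul_le {m : ℕ} {A : Matrix (Fin m) (Fin m) ℝ} (hA : A.IsHermitian)
    (x : EuclideanSpace ℝ (Fin m)) :
    eigenvalueDesc A m * ‖x‖ ^ 2 ≤ ⟪x, Matrix.toEuclideanLin A x⟫ := by
  rw [quadratic_form_eq hA, ← hA.eigenvectorBasis.sum_sq_norm_inner_right, Finset.mul_sum]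
  refine Finset.sum_le_sum fun j _ => ?_
  rw [Real.norm_eq_abs, sq_abs]
  gcongr
  have hm : 1 ≤ m := Fin.pos j
  rw [eigenvalueDesc, dif_pos ⟨hA, hm, le_rfl⟩]
  -- `eigenvalues` is a reindexing of the sorted list `eigenvalues₀`, so only the range of the new
  -- index matters.
  refine hA.eigenvalues₀_antitone ?_
  rw [Fin.le_def]
  have := Fin.is_lt ((Fintype.equivOfCardEq (Fintype.card_fin (Fintype.card (Fin m)))).symm j)
  simp only [Fintype.card_fin] at this ⊢
  omega

lemma le_eigenvalueDesc_one_mul {m : ℕ} {A : Matrix (Fin m) (Fin m) ℝ} (hA : A.IsHermitian)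
    (x : EuclideanSpace ℝ (Fin m)) :
    ⟪x, Matrix.toEuclideanLin A x⟫ ≤ eigenvalueDesc A 1 * ‖x‖ ^ 2 := by
  rw [quadratic_form_eq hA, ← hA.eigenvectorBasis.sum_sq_norm_inner_right, Finset.mul_sum]
  refine Finset.sum_le_sum fun j _ => ?_
  rw [Real.norm_eq_abs, sq_abs]
  gcongr
  have hm : 1 ≤ m := Fin.pos j
  rw [eigenvalueDesc, dif_pos ⟨hA, le_rfl, hm⟩]
  refine hA.eigenvalues₀_antitone ?_
  rw [Fin.le_def]
  simp

lemma norm_le_of_quadratic_form {m : ℕ} {A : Matrix (Fin m) (Fin m) ℝ} {c : ℝ}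
    (x : EuclideanSpace ℝ (Fin m)) (h : c * ‖x‖ ^ 2 ≤ ⟪x, Matrix.toEuclideanLin A x⟫) :
    c * ‖x‖ ≤ ‖Matrix.toEuclideanLin A x‖ := by
  rcases eq_or_lt_of_le (norm_nonneg x) with h0 | h0
  · rw [← h0, mul_zero]; positivity
  · have := h.trans (real_inner_le_norm _ _)
    nlinarith

end Matrices

/-! ### Sub-gaussian and sub-exponential variables -/

section Scalar

variable {Ω : Type*} [MeasurableSpace Ω] {μ : Measure Ω}

lemma integral_cosh_le {Y : Ω → ℝ} {v : ℝ≥0} (hY : HasSubgaussianMGF Y v μ) (s : ℝ) :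
    ∫ ω, (Real.exp (s * Y ω) + Real.exp (-s * Y ω)) ∂μ ≤ 2 * Real.exp (v * s ^ 2 / 2) := by
  rw [integral_add (hY.integrable_exp_mul s) (hY.integrable_exp_mul (-s))]
  have h1 := hY.mgf_le s
  have h2 := hY.mgf_le (-s)
  rw [neg_sq] at h2
  simp only [mgf] at h1 h2
  linarith

lemma exp_abs_le (s a : ℝ) : Real.exp (s * |a|) ≤ Real.exp (s * a) + Real.exp (-s * a) := by
  rcases abs_cases a with ⟨h, _⟩ | ⟨h, _⟩ <;> rw [h]
  · linarith [Real.exp_pos (-s * a)]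
  · rw [mul_neg, ← neg_mul]
    linarith [Real.exp_pos (s * a)]

lemma integral_exp_abs_le {Y : Ω → ℝ} {v : ℝ≥0} (hY : HasSubgaussianMGF Y v μ) (s : ℝ) :
    Integrable (fun ω => Real.exp (s * |Y ω|)) μ ∧
      ∫ ω, Real.exp (s * |Y ω|) ∂μ ≤ 2 * Real.exp (v * s ^ 2 / 2) := by
  have hi := (hY.integrable_exp_mul s).add (hY.integrable_exp_mul (-s))
  have hm := hY.aemeasurable
  have h1 : Integrable (fun ω => Real.exp (s * |Y ω|)) μ := by
    refine hi.mono' (by fun_prop) (ae_of_all _ fun ω => ?_)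
    rw [Real.norm_eq_abs, Real.abs_exp]
    exact exp_abs_le s (Y ω)
  exact ⟨h1, (integral_mono h1 hi fun ω => exp_abs_le s (Y ω)).trans (integral_cosh_le hY s)⟩

/-- A variable dominated by a multiple of a sub-gaussian one is sub-gaussian after centering. -/
lemma hasSubgaussianMGF_of_abs_le [IsProbabilityMeasure μ] {X Y : Ω → ℝ} {v L : ℝ≥0}
    (hX : AEMeasurable X μ) (hXY : ∀ ω, |X ω| ≤ L * |Y ω|) (hY : HasSubgaussianMGF Y v μ) :
    HasSubgaussianMGF (fun ω => X ω - ∫ ω', X ω' ∂μ) (2 * L ^ 2 * v) μ := by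
  -- `cosh` is even and increasing in the absolute value, so domination of `|X|` passes to the
  -- symmetrized exponential.
  have hcosh : ∀ s ω, Real.exp (s * X ω) + Real.exp (-s * X ω) ≤
      Real.exp (s * L * Y ω) + Real.exp (-(s * L) * Y ω) := fun s ω => by
    have h1 : Real.cosh (s * X ω) ≤ Real.cosh (s * L * Y ω) := by
      rw [Real.cosh_le_cosh, abs_mul, abs_mul, abs_mul, mul_assoc, abs_of_nonneg L.coe_nonneg]
      exact mul_le_mul_of_nonneg_left (hXY ω) (abs_nonneg s)
    rw [Real.cosh_eq, Real.cosh_eq] at h1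
    simp only [neg_mul] at h1 ⊢
    linarith
  have hint : ∀ s, Integrable (fun ω => Real.exp (s * X ω)) μ := fun s => by
    refine ((hY.integrable_exp_mul (s * L)).add (hY.integrable_exp_mul (-(s * L)))).mono'
      (by fun_prop) (ae_of_all _ fun ω => ?_)
    rw [Real.norm_eq_abs, Real.abs_exp]
    have := hcosh s ω
    simp only [Pi.add_apply]
    linarith [Real.exp_pos (-s * X ω)]
  have hXi : Integrable X μ := by
    refine (hY.integrable.abs.const_mul (L : ℝ)).mono' hX.aestronglyMeasurable
      (ae_of_all _ fun ω => ?_)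
    rw [Real.norm_eq_abs]
    exact hXY ω
  set m := ∫ ω', X ω' ∂μ with hm
  have hfac : ∀ s, (fun ω => Real.exp (s * (X ω - m))) =
      fun ω => Real.exp (-s * m) * Real.exp (s * X ω) := fun s => by
    funext ω
    rw [← Real.exp_add]
    ring_nf
  refine ⟨fun s => ?_, fun s => ?_⟩
  · rw [hfac]
    exact (hint s).const_mul _
  · rw [mgf, hfac, integral_const_mul]
    set p := ∫ ω, Real.exp (s * X ω) ∂μ with hp
    set q := ∫ ω, Real.exp (-s * X ω) ∂μ with hq
    have hpq : p + q ≤ 2 * Real.exp (v * (s * L) ^ 2 / 2) := by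
      rw [hp, hq, ← integral_add (hint s) (hint (-s))]
      refine (integral_mono ((hint s).add (hint (-s))) ?_ (hcosh s)).trans
        (integral_cosh_le hY (s * L))
      exact (hY.integrable_exp_mul _).add (hY.integrable_exp_mul _)
    have hp0 : 0 ≤ p := integral_nonneg fun ω => (Real.exp_pos _).le
    -- Jensen's inequality, via the tangent line at the mean. The centered moment generating
    -- function is then at most `q p ≤ ((p + q) / 2) ^ 2`, and this square is the source of the
    -- factor `2` in the proxy.
    have hjensen : Real.exp (-s * m) ≤ q := by
      have h1 : ∫ ω, Real.exp (-s * m) * (-s * (X ω - m) + 1) ∂μ = Real.exp (-s * m) := by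
        have h2 : Integrable (fun ω => X ω - m) μ := hXi.sub (integrable_const m)
        rw [integral_const_mul, integral_add (h2.const_mul _) (integrable_const _),
          integral_const_mul, integral_sub hXi (integrable_const m)]
        simp [← hm]
      rw [← h1]
      refine integral_mono ?_ (hint (-s)) fun ω => ?_
      · exact (((hXi.sub (integrable_const m)).const_mul _).add (integrable_const _)).const_mul _
      · calc _ ≤ Real.exp (-s * m) * Real.exp (-s * (X ω - m)) := by
              gcongr
              exact Real.add_one_le_exp _
          _ = _ := by rw [← Real.exp_add]; ring_nf
    have hC : Real.exp (((2 * L ^ 2 * v : ℝ≥0) : ℝ) * s ^ 2 / 2) = Real.exp (v * (s * L) ^ 2 / 2) ^ 2 := by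
      rw [← Real.exp_nat_mul]
      push_cast
      ring_nf
    rw [hC]
    calc _ ≤ q * p := by gcongr
      _ ≤ _ := by
        have hq0 : 0 ≤ q := (Real.exp_pos _).le.trans hjensen
        nlinarith [sq_nonneg (p - q), pow_le_pow_left₀ (add_nonneg hp0 hq0) hpq 2]

lemma lintegral_exp_mul_le {X : Ω → ℝ} {v : ℝ≥0} (hX : HasSubgaussianMGF X v μ) (s : ℝ) :
    ∫⁻ ω, ENNReal.ofReal (Real.exp (s * X ω)) ∂μ ≤ ENNReal.ofReal (Real.exp (v * s ^ 2 / 2)) := by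
  rw [← ofReal_integral_eq_lintegral_ofReal (hX.integrable_exp_mul s)
    (ae_of_all _ fun ω => (Real.exp_pos _).le)]
  exact ENNReal.ofReal_le_ofReal (hX.mgf_le s)

lemma lintegral_gaussianReal_exp_mul (a : ℝ) :
    ∫⁻ g, ENNReal.ofReal (Real.exp (a * g)) ∂(gaussianReal 0 1) =
      ENNReal.ofReal (Real.exp (a ^ 2 / 2)) := by
  rw [← ofReal_integral_eq_lintegral_ofReal (integrable_exp_mul_gaussianReal a)
    (ae_of_all _ fun ω => (Real.exp_pos _).le)]
  congr 1
  have := congrFun (mgf_fun_id_gaussianReal (μ := 0) (v := 1)) a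
  simpa [mgf] using this

/-- The integral equals `(1 - 2b) ^ (-1/2)`, and `(1 - 2b) (1 + 4b) ≥ 1` exactly because `b ≤ 1/4`.
-/
lemma lintegral_gaussianReal_exp_sq {b : ℝ} (hb0 : 0 ≤ b) (hb : b ≤ 1 / 4) :
    ∫⁻ g, ENNReal.ofReal (Real.exp (b * g ^ 2)) ∂(gaussianReal 0 1) ≤
      ENNReal.ofReal (Real.exp (2 * b)) := by
  have hc : 0 < 1 / 2 - b := by linarith
  have hpdf : ∀ g, gaussianPDFReal 0 1 g * Real.exp (b * g ^ 2) =
      (√(2 * Real.pi))⁻¹ * Real.exp (-(1 / 2 - b) * g ^ 2) := fun g => by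
    rw [gaussianPDFReal]
    simp only [NNReal.coe_one, mul_one, sub_zero]
    rw [mul_assoc, ← Real.exp_add]
    ring_nf
  rw [gaussianReal_of_var_ne_zero _ one_ne_zero,
    lintegral_withDensity_eq_lintegral_mul _ (measurable_gaussianPDF 0 1) (by fun_prop)]
  have h1 : ∀ g, (gaussianPDF 0 1 * fun g => ENNReal.ofReal (Real.exp (b * g ^ 2))) g =
      ENNReal.ofReal ((√(2 * Real.pi))⁻¹ * Real.exp (-(1 / 2 - b) * g ^ 2)) := fun g => by
    rw [Pi.mul_apply, gaussianPDF, ← ENNReal.ofReal_mul (gaussianPDFReal_nonneg 0 1 g), hpdf]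
  simp_rw [h1]
  rw [← ofReal_integral_eq_lintegral_ofReal ((integrable_exp_neg_mul_sq hc).const_mul _)
    (ae_of_all _ fun ω => by positivity), integral_const_mul, integral_gaussian]
  refine ENNReal.ofReal_le_ofReal ?_
  rw [← Real.sqrt_inv, ← Real.sqrt_mul (by positivity)]
  refine Real.sqrt_le_iff.2 ⟨(Real.exp_pos _).le, ?_⟩
  have h2 : (2 * Real.pi)⁻¹ * (Real.pi / (1 / 2 - b)) = (1 - 2 * b)⁻¹ := by
    have := Real.pi_pos
    field_simp
  rw [h2, ← Real.exp_nat_mul]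
  have h3 : 1 + 4 * b ≤ Real.exp (4 * b) := by linarith [Real.add_one_le_exp (4 * b)]
  have h4 : 0 < 1 - 2 * b := by linarith
  rw [inv_le_iff_one_le_mul₀ h4]
  push_cast
  rw [show 2 * (2 * b) = 4 * b by ring]
  nlinarith

/-- Gaussian linearization: `exp (b X²)` is the average of `exp (√(2b) X g)` over a standard
Gaussian `g`. After swapping integrals the sub-gaussian bound leaves the Gaussian integral of `exp
(b v g²)`. -/
lemma lintegral_exp_sq_le [SFinite μ] {X : Ω → ℝ} (hm : Measurable X) {v : ℝ≥0}
    (hX : HasSubgaussianMGF X v μ) {b : ℝ} (hb0 : 0 ≤ b) (hb : b * v ≤ 1 / 4) :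
    ∫⁻ ω, ENNReal.ofReal (Real.exp (b * X ω ^ 2)) ∂μ ≤ ENNReal.ofReal (Real.exp (2 * (b * v))) := by
  have h1 : ∀ ω, ENNReal.ofReal (Real.exp (b * X ω ^ 2)) =
      ∫⁻ g, ENNReal.ofReal (Real.exp (√(2 * b) * X ω * g)) ∂(gaussianReal 0 1) := fun ω => by
    rw [lintegral_gaussianReal_exp_mul, mul_pow, Real.sq_sqrt (by positivity)]
    ring_nf
  simp_rw [h1]
  rw [lintegral_lintegral_swap (by fun_prop)]
  refine le_trans (lintegral_mono fun g => ?_) (lintegral_gaussianReal_exp_sq (by positivity) hb)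
  have h2 := lintegral_exp_mul_le hX (√(2 * b) * g)
  rw [mul_pow, Real.sq_sqrt (by positivity)] at h2
  calc _ = ∫⁻ ω, ENNReal.ofReal (Real.exp (√(2 * b) * g * X ω)) ∂μ := by
        congr with ω; ring_nf
    _ ≤ _ := h2
    _ = _ := by ring_nf

/-- The product of two independent sub-gaussian variables is sub-exponential. -/
lemma lintegral_exp_mul_mul_le [IsProbabilityMeasure μ] {X Y : Ω → ℝ} (hXm : Measurable X)
    (hYm : Measurable Y) {v w : ℝ≥0} (hX : HasSubgaussianMGF X v μ) (hY : HasSubgaussianMGF Y w μ)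
    (hXY : IndepFun X Y μ) {s : ℝ} (hs : s ^ 2 * (v * w) ≤ 1 / 2) :
    ∫⁻ ω, ENNReal.ofReal (Real.exp (s * (X ω * Y ω))) ∂μ ≤
      ENNReal.ofReal (Real.exp (s ^ 2 * (v * w))) := by
  have hpX := Measure.isProbabilityMeasure_map (μ := μ) hXm.aemeasurable
  have hpY := Measure.isProbabilityMeasure_map (μ := μ) hYm.aemeasurable
  have h1 : ∫⁻ ω, ENNReal.ofReal (Real.exp (s * (X ω * Y ω))) ∂μ =
      ∫⁻ p, ENNReal.ofReal (Real.exp (s * (p.1 * p.2))) ∂((μ.map X).prod (μ.map Y)) := by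
    rw [← hXY.map_prod_eq_prod_map_map hXm.aemeasurable hYm.aemeasurable,
      lintegral_map (by fun_prop) (by fun_prop)]
  rw [h1, lintegral_prod _ (by fun_prop), lintegral_map (by fun_prop) hXm]
  -- With `X` frozen, integrating out `Y` leaves `exp (b X²)` for `b = w s² / 2`; the requirement `b
  -- v ≤ 1/4` is the hypothesis on `s`.
  have h2 : ∀ ω, ∫⁻ y, ENNReal.ofReal (Real.exp (s * (X ω * y))) ∂(μ.map Y) ≤
      ENNReal.ofReal (Real.exp (w * s ^ 2 / 2 * X ω ^ 2)) := fun ω => by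
    rw [lintegral_map (by fun_prop) hYm]
    have h3 := lintegral_exp_mul_le hY (s * X ω)
    simp_rw [← mul_assoc]
    refine h3.trans (le_of_eq ?_)
    ring_nf
  refine (lintegral_mono h2).trans
    ((lintegral_exp_sq_le hXm hX (by positivity) (by linarith)).trans (le_of_eq ?_))
  ring_nf

lemma measure_le_of_lintegral_exp {X : Ω → ℝ} (hX : AEMeasurable X μ) {s t a τ : ℝ} (hs : 0 ≤ s)
    (h : ∫⁻ ω, ENNReal.ofReal (Real.exp (s * X ω)) ∂μ ≤ ENNReal.ofReal (Real.exp a))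
    (hτ : τ ≤ s * t - a) : μ {ω | t ≤ X ω} ≤ ENNReal.ofReal (Real.exp (-τ)) := by
  have h1 : {ω | t ≤ X ω} ⊆
      {ω | ENNReal.ofReal (Real.exp (s * t)) ≤ ENNReal.ofReal (Real.exp (s * X ω))} := fun ω hω =>
    ENNReal.ofReal_le_ofReal (Real.exp_le_exp.2 (mul_le_mul_of_nonneg_left hω hs))
  refine (measure_mono h1).trans ((meas_ge_le_lintegral_div (by fun_prop)
    (by simp [Real.exp_pos]) (by simp)).trans ?_)
  calc _ ≤ ENNReal.ofReal (Real.exp a) / ENNReal.ofReal (Real.exp (s * t)) := by gcongr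
    _ = ENNReal.ofReal (Real.exp (a - s * t)) := by
        rw [← ENNReal.ofReal_div_of_pos (Real.exp_pos _), Real.exp_sub]
    _ ≤ _ := ENNReal.ofReal_le_ofReal (Real.exp_le_exp.2 (by linarith))

/-- Bernstein's inequality for sums of independent sub-exponential variables. -/
lemma measure_sum_ge_le_of_subexponential {ι : Type*} [Fintype ι] {ξ : ι → Ω → ℝ}
    (hind : iIndepFun ξ μ) (hm : ∀ i, Measurable (ξ i)) {V τ : ℝ} (hV : 0 < V) (hτ : 0 < τ)
    (hξ : ∀ i s, s ^ 2 * V ^ 2 ≤ 1 / 2 → ∫⁻ ω, ENNReal.ofReal (Real.exp (s * ξ i ω)) ∂μ ≤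
      ENNReal.ofReal (Real.exp (s ^ 2 * V ^ 2))) :
    μ {ω | 4 * V * (√(Fintype.card ι * τ) + τ) ≤ ∑ i, ξ i ω} ≤
      ENNReal.ofReal (Real.exp (-τ)) := by
  have hsum : ∀ s, s ^ 2 * V ^ 2 ≤ 1 / 2 →
      ∫⁻ ω, ENNReal.ofReal (Real.exp (s * ∑ i, ξ i ω)) ∂μ ≤
        ENNReal.ofReal (Real.exp (Fintype.card ι * (s ^ 2 * V ^ 2))) := fun s hs => by
    have h1 : ∀ ω, ENNReal.ofReal (Real.exp (s * ∑ i, ξ i ω)) =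
        ∏ i, ENNReal.ofReal (Real.exp (s * ξ i ω)) := fun ω => by
      rw [Finset.mul_sum, Real.exp_sum, ENNReal.ofReal_prod_of_nonneg fun i _ => (Real.exp_pos _).le]
    simp_rw [h1]
    rw [lintegral_prod_eq_prod_lintegral_of_indepFun Finset.univ
      (fun i ω => ENNReal.ofReal (Real.exp (s * ξ i ω)))
      (hind.comp (fun _ x => ENNReal.ofReal (Real.exp (s * x))) fun _ => by fun_prop)
      fun i => by have := hm i; fun_prop]
    refine (Finset.prod_le_prod' fun i _ => hξ i s hs).trans (le_of_eq ?_)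
    rw [Finset.prod_const, ← ENNReal.ofReal_pow (Real.exp_pos _).le, ← Real.exp_nat_mul,
      Finset.card_univ]
  set m : ℝ := (Fintype.card ι : ℝ) with hmdef
  have hm0 : 0 ≤ m := by positivity
  have hmeas : AEMeasurable (fun ω => ∑ i, ξ i ω) μ :=
    (Finset.measurable_fun_sum _ fun i _ => hm i).aemeasurable
  -- The sub-gaussian choice `s = √(τ/m) / V` is admissible only for small `τ / m`. Otherwise `s = 1
  -- / (2V)` costs `m / 4 < τ`, which the linear term `2τ` absorbs.
  rcases le_or_gt (4 * τ) m with h | h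
  · have hmpos : 0 < m := by linarith
    have hr : √(τ / m) ^ 2 = τ / m := Real.sq_sqrt (by positivity)
    have hsV : (√(τ / m) / V) ^ 2 * V ^ 2 = τ / m := by
      rw [div_pow, hr]; field_simp
    refine measure_le_of_lintegral_exp hmeas (s := √(τ / m) / V) (by positivity) (hsum _ ?_) ?_
    · rw [hsV, div_le_iff₀ hmpos]; linarith
    · rw [hsV]
      have h1 : √(τ / m) * √(m * τ) = τ := by
        rw [← Real.sqrt_mul (by positivity), show τ / m * (m * τ) = τ ^ 2 by field_simp,
          Real.sqrt_sq hτ.le]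
      have h2 : √(τ / m) / V * (4 * V * (√(m * τ) + τ)) =
          4 * (√(τ / m) * √(m * τ)) + 4 * (√(τ / m) * τ) := by
        field_simp
      rw [h2, h1, mul_div_cancel₀ _ hmpos.ne']
      have : 0 ≤ √(τ / m) * τ := by positivity
      linarith
  · have hsV : (1 / (2 * V)) ^ 2 * V ^ 2 = 1 / 4 := by field_simp; norm_num
    refine measure_le_of_lintegral_exp hmeas (s := 1 / (2 * V)) (by positivity) (hsum _ ?_) ?_
    · rw [hsV]; norm_num
    · rw [hsV]
      have h2 : 1 / (2 * V) * (4 * V * (√(m * τ) + τ)) = 2 * √(m * τ) + 2 * τ := by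
        field_simp; ring
      rw [h2]
      have : 0 ≤ √(m * τ) := Real.sqrt_nonneg _
      linarith

lemma HasSubgaussianMGF_mono {X : Ω → ℝ} {v w : ℝ≥0} (hX : HasSubgaussianMGF X v μ) (h : v ≤ w) :
    HasSubgaussianMGF X w μ :=
  ⟨hX.integrable_exp_mul, fun t => (hX.mgf_le t).trans (Real.exp_le_exp.2 (by gcongr))⟩

lemma hasSubgaussianMGF_const_mul {X : Ω → ℝ} {v w : ℝ≥0} (hX : HasSubgaussianMGF X v μ) {r : ℝ}
    (h : r ^ 2 * v ≤ w) : HasSubgaussianMGF (fun ω => r * X ω) w μ := by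
  refine ⟨fun t => ?_, fun t => ?_⟩
  · simpa only [← mul_assoc] using hX.integrable_exp_mul (t * r)
  · have h1 := hX.mgf_le (t * r)
    simp only [mgf, mul_assoc] at h1 ⊢
    refine h1.trans (Real.exp_le_exp.2 ?_)
    rw [mul_pow]
    nlinarith [sq_nonneg t]

lemma measure_ge_le_of_hasSubgaussianMGF [IsProbabilityMeasure μ] {X : Ω → ℝ} {v : ℝ≥0}
    (hX : HasSubgaussianMGF X v μ) {G τ : ℝ} (hvG : v ≤ G) (hG : 0 < G) (hτ : 0 ≤ τ) :
    μ {ω | √(2 * G * τ) ≤ X ω} ≤ ENNReal.ofReal (Real.exp (-τ)) := by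
  have h := (HasSubgaussianMGF_mono (w := G.toNNReal) hX
    (NNReal.le_toNNReal_of_coe_le hvG)).measure_ge_le (Real.sqrt_nonneg (2 * G * τ))
  rw [Real.sq_sqrt (by positivity), Real.coe_toNNReal _ hG.le,
    show -(2 * G * τ) / (2 * G) = -τ by field_simp] at h
  rw [← ENNReal.ofReal_toReal (measure_ne_top μ {ω | √(2 * G * τ) ≤ X ω})]
  exact ENNReal.ofReal_le_ofReal h

end Scalar

/-! ### Nets of the unit sphere -/

section Net

open Module
open scoped RealInnerProductSpace

variable {E : Type*} [NormedAddCommGroup E] [InnerProductSpace ℝ E] [FiniteDimensional ℝ E]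

variable (E) in
-- A `1/2`-separated set of maximal cardinality is a net. Doubling it gives a `1`-separated subset
-- of the ball of radius `2`, to which the Besicovitch packing bound applies.
lemma exists_half_net : ∃ S : Finset E, (∀ u ∈ S, ‖u‖ = 1) ∧ S.card ≤ 5 ^ finrank ℝ E ∧
    ∀ x : E, ‖x‖ = 1 → ∃ u ∈ S, ‖x - u‖ ≤ 1 / 2 := by
  classical
  let P : ℕ → Prop := fun m => ∃ S : Finset E, (∀ u ∈ S, ‖u‖ = 1) ∧
    (∀ u ∈ S, ∀ v ∈ S, u ≠ v → 1 / 2 ≤ ‖u - v‖) ∧ S.card = m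
  have hbound : ∀ S : Finset E, (∀ u ∈ S, ‖u‖ = 1) →
      (∀ u ∈ S, ∀ v ∈ S, u ≠ v → 1 / 2 ≤ ‖u - v‖) → S.card ≤ 5 ^ finrank ℝ E := by
    intro S h1 h2
    have hinj : Function.Injective fun u : E => (2 : ℝ) • u := smul_right_injective E two_ne_zero
    rw [← Finset.card_image_of_injective S hinj]
    refine Besicovitch.card_le_of_separated _ ?_ ?_
    · simp only [Finset.mem_image, forall_exists_index, and_imp, forall_apply_eq_imp_iff₂]
      intro u hu
      rw [norm_smul, h1 u hu]; norm_num
    · simp only [Finset.mem_image, forall_exists_index, and_imp, forall_apply_eq_imp_iff₂]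
      intro u hu v hv huv
      have h3 := h2 u hu v hv fun h => huv (by rw [h])
      rw [← smul_sub, norm_smul, Real.norm_two]
      linarith
  obtain ⟨S, h1, h2, h3⟩ : P (Nat.findGreatest P (5 ^ finrank ℝ E)) :=
    Nat.findGreatest_spec (m := 0) (Nat.zero_le _) ⟨∅, by simp⟩
  refine ⟨S, h1, hbound S h1 h2, fun x hx => ?_⟩
  by_contra! hcon
  have hxS : x ∉ S := fun h => by have := hcon x h; simp at this; linarith
  have h1' : ∀ u ∈ insert x S, ‖u‖ = 1 := by
    intro u hu
    rcases Finset.mem_insert.1 hu with rfl | hu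
    exacts [hx, h1 u hu]
  have h2' : ∀ u ∈ insert x S, ∀ v ∈ insert x S, u ≠ v → 1 / 2 ≤ ‖u - v‖ := by
    intro u hu v hv huv
    rcases Finset.mem_insert.1 hu with rfl | hu' <;> rcases Finset.mem_insert.1 hv with rfl | hv'
    · exact absurd rfl huv
    · exact (hcon v hv').le
    · rw [norm_sub_rev]; exact (hcon u hu').le
    · exact h2 u hu' v hv' huv
  have h4 := Nat.le_findGreatest (P := P) (hbound _ h1' h2') ⟨_, h1', h2', rfl⟩
  rw [Finset.card_insert_of_notMem hxS] at h4
  omega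

/-- Passing from the net to the sphere loses a factor `2` in each argument of the bilinear form. -/
lemma norm_le_of_half_net {S : Finset E} (hS : ∀ x : E, ‖x‖ = 1 → ∃ u ∈ S, ‖x - u‖ ≤ 1 / 2)
    (A : E →ₗ[ℝ] E) {t : ℝ} (ht : 0 ≤ t) (h : ∀ u ∈ S, ∀ v ∈ S, ⟪u, A v⟫ ≤ t) (x : E) :
    ‖A x‖ ≤ 4 * t * ‖x‖ := by
  have h1 : ∀ v ∈ S, ‖A v‖ ≤ 2 * t := fun v hv => by
    rcases eq_or_ne (A v) 0 with h0 | h0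
    · rw [h0, norm_zero]; positivity
    · have hpos : 0 < ‖A v‖ := norm_pos_iff.2 h0
      obtain ⟨u, hu, hwu⟩ := hS (‖A v‖⁻¹ • A v) (norm_smul_inv_norm h0)
      have h2 : ‖A v‖ = ⟪u, A v⟫ + ⟪‖A v‖⁻¹ • A v - u, A v⟫ := by
        rw [inner_sub_left, real_inner_smul_left, real_inner_self_eq_norm_sq]
        field_simp; ring
      have h3 : ⟪‖A v‖⁻¹ • A v - u, A v⟫ ≤ 1 / 2 * ‖A v‖ :=
        (real_inner_le_norm _ _).trans (by gcongr)
      linarith [h u hu v hv]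
  let K := LinearMap.toContinuousLinearMap A
  have hK : ‖K‖ ≤ 2 * t + ‖K‖ / 2 := by
    refine ContinuousLinearMap.opNorm_le_of_unit_norm (by positivity) fun x hx => ?_
    obtain ⟨v, hv, hxv⟩ := hS x hx
    calc ‖K x‖ = ‖K v + K (x - v)‖ := by rw [← map_add]; simp
      _ ≤ ‖K v‖ + ‖K (x - v)‖ := norm_add_le _ _
      _ ≤ 2 * t + ‖K‖ * (1 / 2) := by
          gcongr
          · exact h1 v hv
          · exact (K.le_opNorm _).trans (by gcongr)
      _ = _ := by ring
  calc ‖A x‖ = ‖K x‖ := rfl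
    _ ≤ ‖K‖ * ‖x‖ := K.le_opNorm x
    _ ≤ _ := by gcongr; linarith

end Net

/-! ### One sample -/

section Sample

open scoped RealInnerProductSpace

variable {Ω : Type*} [MeasurableSpace Ω] {μ : Measure Ω} {d : ℕ}

lemma memLp_two_of_hasSubgaussianMGF {X : Ω → ℝ} {v : ℝ≥0} (h : HasSubgaussianMGF X v μ) :
    MemLp X 2 μ := by
  simpa using h.memLp 2

lemma IsSubGaussian.integrable [IsFiniteMeasure μ] {X : Ω → ℝ} {v : ℝ≥0} (h : IsSubGaussian μ X v) :
    Integrable X μ := by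
  have h1 := (HasSubgaussianMGF.integrable h).add (integrable_const (∫ ω', X ω' ∂μ))
  refine h1.congr (ae_of_all _ fun ω => ?_)
  simp

lemma IsSubGaussian.hasSubgaussianMGF {X : Ω → ℝ} {v : ℝ≥0} (h : IsSubGaussian μ X v)
    (h0 : ∫ ω, X ω ∂μ = 0) : HasSubgaussianMGF X v μ := by
  simpa [IsSubGaussian, h0] using h

/-- Chernoff with exponent `1` instead of the optimal one: an exponential tail suffices, since `L`
will be a multiple of `log (d + N)`. -/
lemma measure_abs_gt_le {y : Ω → ℝ} {v : ℝ≥0} (hy : HasSubgaussianMGF y v μ) (L : ℝ) :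
    μ {ω | L < |y ω|} ≤ ENNReal.ofReal (Real.exp (-L) * (2 * Real.exp (v / 2))) := by
  obtain ⟨hi, he⟩ := integral_exp_abs_le hy 1
  have hm := hy.aemeasurable
  have h1 : ∫⁻ ω, ENNReal.ofReal (Real.exp (1 * |y ω|)) ∂μ ≤
      ENNReal.ofReal (Real.exp (Real.log 2 + v / 2)) := by
    rw [← ofReal_integral_eq_lintegral_ofReal hi (ae_of_all _ fun ω => (Real.exp_pos _).le),
      Real.exp_add, Real.exp_log two_pos]
    refine ENNReal.ofReal_le_ofReal (he.trans (le_of_eq ?_))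
    ring_nf
  refine (measure_mono fun ω (hω : L < |y ω|) => hω.le).trans
    ((measure_le_of_lintegral_exp (t := L) (τ := L - (Real.log 2 + v / 2)) (by fun_prop)
      zero_le_one h1 (by linarith)).trans (le_of_eq ?_))
  rw [neg_sub, sub_eq_add_neg, add_comm, Real.exp_add, Real.exp_add, Real.exp_log two_pos]

variable [IsProbabilityMeasure μ] {x : Ω → EuclideanSpace ℝ (Fin d)} {γ2 : ℝ≥0}

lemma IsSubGaussianVector.integrable (hx : IsSubGaussianVector μ x γ2) : Integrable x μ := by
  refine Integrable.of_eval_piLp fun a => ?_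
  have h := (hx (EuclideanSpace.single a 1) (by simp)).integrable
  simpa [EuclideanSpace.inner_single_left] using h

lemma IsSubGaussianVector.hasSubgaussianMGF_unit (hx : IsSubGaussianVector μ x γ2)
    (h0 : ∫ ω, x ω ∂μ = 0) {u : EuclideanSpace ℝ (Fin d)} (hu : ‖u‖ = 1) :
    HasSubgaussianMGF (fun ω => ⟪u, x ω⟫) γ2 μ :=
  (hx u hu).hasSubgaussianMGF (by rw [integral_inner hx.integrable, h0, inner_zero_right])

lemma IsSubGaussianVector.hasSubgaussianMGF (hx : IsSubGaussianVector μ x γ2)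
    (h0 : ∫ ω, x ω ∂μ = 0) {u : EuclideanSpace ℝ (Fin d)} {R : ℝ≥0} (hu : ‖u‖ ≤ R) :
    HasSubgaussianMGF (fun ω => ⟪u, x ω⟫) (R ^ 2 * γ2) μ := by
  rcases eq_or_ne u 0 with rfl | hu0
  · simp only [inner_zero_left]
    exact HasSubgaussianMGF_mono HasSubgaussianMGF.fun_zero (by positivity)
  · have h1 := hx.hasSubgaussianMGF_unit h0
      (norm_smul_inv_norm hu0 : ‖(‖u‖⁻¹ : ℝ) • u‖ = 1)
    have h2 : (fun ω => ⟪u, x ω⟫) = fun ω => ‖u‖ * ⟪‖u‖⁻¹ • u, x ω⟫ := by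
      funext ω
      rw [real_inner_smul_left, mul_inv_cancel_left₀ (norm_ne_zero_iff.2 hu0)]
    rw [h2]
    refine hasSubgaussianMGF_const_mul h1 ?_
    rw [NNReal.coe_mul, NNReal.coe_pow]
    gcongr

lemma integral_inner_mul_inner (hx : IsSubGaussianVector μ x γ2) (h0 : ∫ ω, x ω ∂μ = 0)
    (u θ : EuclideanSpace ℝ (Fin d)) :
    ∫ ω, ⟪x ω, θ⟫ * ⟪u, x ω⟫ ∂μ = ⟪u, Matrix.toEuclideanLin (secondMoment μ x) θ⟫ := by
  have hc : ∀ a, MemLp (fun ω => x ω a) 2 μ := fun a => by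
    have h := memLp_two_of_hasSubgaussianMGF
      (hx.hasSubgaussianMGF_unit h0 (u := EuclideanSpace.single a 1) (by simp))
    simpa [EuclideanSpace.inner_single_left] using h
  have hi : ∀ a b, Integrable (fun ω => x ω a * x ω b) μ := fun a b =>
    (hc a).integrable_mul (hc b)
  have h1 : ∀ ω, ⟪x ω, θ⟫ * ⟪u, x ω⟫ = ∑ a, ∑ b, u a * θ b * (x ω a * x ω b) := fun ω => by
    simp only [PiLp.inner_apply, RCLike.inner_apply, conj_trivial]
    rw [mul_comm, Finset.sum_mul_sum]
    refine Finset.sum_congr rfl fun a _ => Finset.sum_congr rfl fun b _ => ?_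
    ring
  simp_rw [h1]
  rw [integral_finsetSum _ fun a _ => integrable_finsetSum _ fun b _ => (hi a b).const_mul _]
  simp only [PiLp.inner_apply, RCLike.inner_apply, conj_trivial]
  refine Finset.sum_congr rfl fun a _ => ?_
  rw [integral_finsetSum _ fun b _ => (hi a b).const_mul _]
  simp only [Matrix.toLpLin_apply, Matrix.mulVec, dotProduct, secondMoment, Matrix.of_apply,
    Finset.sum_mul, integral_const_mul]
  refine Finset.sum_congr rfl fun b _ => ?_
  ring

/-- The response-weighted covariate `y x`, set to zero when `|y|` exceeds `L`. -/
noncomputable def truncatedProduct (L : ℝ) (y : ℝ) (x : EuclideanSpace ℝ (Fin d)) :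
    EuclideanSpace ℝ (Fin d) :=
  (Set.Icc (-L) L).indicator id y • x

lemma measurable_truncatedProduct (L : ℝ) :
    Measurable fun p : EuclideanSpace ℝ (Fin d) × ℝ => truncatedProduct L p.2 p.1 := by
  unfold truncatedProduct
  exact ((measurable_id.indicator measurableSet_Icc).comp measurable_snd).smul measurable_fst

lemma truncatedProduct_of_abs_le {L y : ℝ} (h : |y| ≤ L) (x : EuclideanSpace ℝ (Fin d)) :
    truncatedProduct L y x = y • x := by
  rw [truncatedProduct, Set.indicator_of_mem (Set.mem_Icc.2 (abs_le.1 h)), id]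

lemma abs_inner_truncatedProduct_le {L : ℝ} (hL : 0 ≤ L) (y : ℝ)
    (u x : EuclideanSpace ℝ (Fin d)) : |⟪u, truncatedProduct L y x⟫| ≤ L * |⟪u, x⟫| := by
  rw [truncatedProduct, real_inner_smul_right, abs_mul]
  gcongr
  by_cases h : y ∈ Set.Icc (-L) L
  · rw [Set.indicator_of_mem h]; exact abs_le.2 h
  · rw [Set.indicator_of_notMem h, abs_zero]; exact hL

/-- Where truncation acts, `1 ≤ exp (|y| - L)`. The AM-GM inequality then separates `y` from `w`,
which are dependent in the application, into individual exponential moments. -/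
lemma truncation_error_le {L y w : ℝ} (z : ℝ) (hz : z = (Set.Icc (-L) L).indicator id y) :
    |(y - z) * w| ≤ Real.exp (-L) * ((Real.exp (4 * |y|) + Real.exp (2 * |w|)) / 2) := by
  by_cases h : y ∈ Set.Icc (-L) L
  · rw [hz, Set.indicator_of_mem h, id, sub_self, zero_mul, abs_zero]
    positivity
  · have hL : L < |y| := by
      by_contra! hcon
      exact h (abs_le.1 hcon)
    rw [hz, Set.indicator_of_notMem h, sub_zero, abs_mul]
    have h1 : |y| ≤ Real.exp |y| := by linarith [Real.add_one_le_exp |y|]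
    have h2 : |w| ≤ Real.exp |w| := by linarith [Real.add_one_le_exp |w|]
    calc |y| * |w| ≤ Real.exp |y| * Real.exp |w| := by gcongr
      _ ≤ Real.exp (-L + 2 * |y|) * Real.exp |w| := by gcongr; linarith
      _ = Real.exp (-L) * (Real.exp (2 * |y|) * Real.exp |w|) := by rw [Real.exp_add, mul_assoc]
      _ ≤ _ := by
        gcongr
        have h3 : Real.exp (4 * |y|) = Real.exp (2 * |y|) ^ 2 := by
          rw [← Real.exp_nat_mul]; push_cast; ring_nf
        have h4 : Real.exp (2 * |w|) = Real.exp |w| ^ 2 := by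
          rw [← Real.exp_nat_mul]; push_cast; rfl
        rw [h3, h4]
        nlinarith [sq_nonneg (Real.exp (2 * |y|) - Real.exp |w|)]

variable {y : Ω → ℝ} {θ : EuclideanSpace ℝ (Fin d)} {σ2 R : ℝ≥0}

lemma hasSubgaussianMGF_response (hx : IsSubGaussianVector μ x γ2)
    (h0 : ∫ ω, x ω ∂μ = 0) (hξ : IsSubGaussian μ (fun ω => y ω - ⟪x ω, θ⟫) σ2)
    (hξ0 : ∫ ω, (y ω - ⟪x ω, θ⟫) ∂μ = 0) (hind : IndepFun (fun ω => y ω - ⟪x ω, θ⟫) x μ)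
    (hθ : ‖θ‖ ≤ R) : HasSubgaussianMGF y (σ2 + R ^ 2 * γ2) μ := by
  have h1 := (hξ.hasSubgaussianMGF hξ0).add_of_indepFun (hx.hasSubgaussianMGF h0 hθ)
    (hind.comp measurable_id (ψ := fun z => ⟪θ, z⟫) (by fun_prop))
  refine h1.congr (ae_of_all _ fun ω => ?_)
  simp only
  rw [real_inner_comm]
  ring

/-- The independent, centered noise contributes nothing, so `E[y x] = Γ θ`. This is what makes the
averages estimate `B α`. -/
lemma integral_response_mul (hx : IsSubGaussianVector μ x γ2)
    (h0 : ∫ ω, x ω ∂μ = 0) (hξ : IsSubGaussian μ (fun ω => y ω - ⟪x ω, θ⟫) σ2)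
    (hξ0 : ∫ ω, (y ω - ⟪x ω, θ⟫) ∂μ = 0) (hind : IndepFun (fun ω => y ω - ⟪x ω, θ⟫) x μ)
    {u : EuclideanSpace ℝ (Fin d)} (hu : ‖u‖ = 1) :
    Integrable (fun ω => y ω * ⟪u, x ω⟫) μ ∧
      ∫ ω, y ω * ⟪u, x ω⟫ ∂μ = ⟪u, Matrix.toEuclideanLin (secondMoment μ x) θ⟫ := by
  have hu' := memLp_two_of_hasSubgaussianMGF (hx.hasSubgaussianMGF_unit h0 hu)
  have hξ' := memLp_two_of_hasSubgaussianMGF (hξ.hasSubgaussianMGF hξ0)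
  have hθ' : MemLp (fun ω => ⟪x ω, θ⟫) 2 μ := by
    have := memLp_two_of_hasSubgaussianMGF
      (hx.hasSubgaussianMGF h0 (u := θ) (R := ‖θ‖₊) le_rfl)
    simpa only [real_inner_comm] using this
  have h1 : (fun ω => y ω * ⟪u, x ω⟫) =
      fun ω => ⟪x ω, θ⟫ * ⟪u, x ω⟫ + (y ω - ⟪x ω, θ⟫) * ⟪u, x ω⟫ := by
    funext ω; ring
  have hi1 : Integrable (fun ω => ⟪x ω, θ⟫ * ⟪u, x ω⟫) μ := hθ'.integrable_mul hu'
  have hi2 : Integrable (fun ω => (y ω - ⟪x ω, θ⟫) * ⟪u, x ω⟫) μ := hξ'.integrable_mul hu'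
  rw [h1]
  refine ⟨hi1.add hi2, ?_⟩
  have hind' : IndepFun (fun ω => y ω - ⟪x ω, θ⟫) (fun ω => ⟪u, x ω⟫) μ :=
    hind.comp measurable_id (ψ := fun z => ⟪u, z⟫) (by fun_prop)
  rw [integral_add hi1 hi2, integral_inner_mul_inner hx h0,
    hind'.integral_fun_mul_eq_mul_integral hξ'.1 hu'.1, hξ0, zero_mul, add_zero]

lemma truncation_bias_le (hxm : Measurable x) (hym : Measurable y)
    (hx : IsSubGaussianVector μ x γ2)
    (h0 : ∫ ω, x ω ∂μ = 0) (hξ : IsSubGaussian μ (fun ω => y ω - ⟪x ω, θ⟫) σ2)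
    (hξ0 : ∫ ω, (y ω - ⟪x ω, θ⟫) ∂μ = 0) (hind : IndepFun (fun ω => y ω - ⟪x ω, θ⟫) x μ)
    (hθ : ‖θ‖ ≤ R) {L : ℝ} (hL : 0 ≤ L) {u : EuclideanSpace ℝ (Fin d)} (hu : ‖u‖ = 1) :
    |∫ ω, ⟪u, truncatedProduct L (y ω) (x ω)⟫ ∂μ -
        ⟪u, Matrix.toEuclideanLin (secondMoment μ x) θ⟫| ≤
      Real.exp (-L) * (Real.exp (8 * (σ2 + R ^ 2 * γ2)) + Real.exp (2 * γ2)) := by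
  obtain ⟨hi, he⟩ := integral_response_mul hx h0 hξ hξ0 hind hu
  have hy := hasSubgaussianMGF_response hx h0 hξ hξ0 hind hθ
  have hu' := hx.hasSubgaussianMGF_unit h0 hu
  have hT : Measurable fun ω => truncatedProduct L (y ω) (x ω) :=
    (measurable_truncatedProduct L).comp (hxm.prodMk hym)
  have hTi : Integrable (fun ω => ⟪u, truncatedProduct L (y ω) (x ω)⟫) μ := by
    refine (hu'.integrable.abs.const_mul L).mono'
      (measurable_const.inner hT).aestronglyMeasurable (ae_of_all _ fun ω => ?_)
    exact abs_inner_truncatedProduct_le hL _ _ _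
  obtain ⟨hi1, he1⟩ := integral_exp_abs_le hy 4
  obtain ⟨hi2, he2⟩ := integral_exp_abs_le hu' 2
  rw [← he, abs_sub_comm, ← integral_sub hi hTi, ← Real.norm_eq_abs]
  refine (norm_integral_le_integral_norm _).trans ?_
  have hpt : ∀ ω, ‖y ω * ⟪u, x ω⟫ - ⟪u, truncatedProduct L (y ω) (x ω)⟫‖ ≤
      Real.exp (-L) * ((Real.exp (4 * |y ω|) + Real.exp (2 * |⟪u, x ω⟫|)) / 2) := fun ω => by
    rw [truncatedProduct, real_inner_smul_right, ← sub_mul]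
    exact truncation_error_le _ rfl
  refine (integral_mono (hi.sub hTi).norm (((hi1.add hi2).div_const 2).const_mul _) hpt).trans ?_
  simp only [Pi.add_apply]
  rw [integral_const_mul, integral_div, integral_add hi1 hi2]
  push_cast at he1
  gcongr
  rw [show (σ2 + R ^ 2 * γ2 : ℝ) * 4 ^ 2 / 2 = 8 * (σ2 + R ^ 2 * γ2) by ring] at he1
  rw [show (γ2 : ℝ) * 2 ^ 2 / 2 = 2 * γ2 by ring] at he2
  linarith

end Sample

/-! ### Concentration of sums over clients -/

section Concentration

open scoped RealInnerProductSpace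

variable {Ω : Type*} [MeasurableSpace Ω] {μ : Measure Ω}

/-- Currying carries the product law over all samples to a product over clients of product laws;
hence whole clients are independent blocks. -/
lemma iIndepFun_curry {ι β : Type*} {κ : ι → Type*} [MeasurableSpace β]
    {X : ((i : ι) × κ i) → Ω → β} (hm : ∀ p, Measurable (X p)) (h : iIndepFun X μ) :
    iIndepFun (fun i ω (j : κ i) => X ⟨i, j⟩ ω) μ := by
  have := h.isProbabilityMeasure
  have : ∀ p, IsProbabilityMeasure (μ.map (X p)) :=
    fun p => Measure.isProbabilityMeasure_map (hm p).aemeasurable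
  have hsub : ∀ i, iIndepFun (fun (j : κ i) ω => X ⟨i, j⟩ ω) μ := fun i =>
    h.precomp (g := fun j : κ i => (⟨i, j⟩ : (i : ι) × κ i)) sigma_mk_injective
  have hcomp : (MeasurableEquiv.piCurry fun (i : ι) (_ : κ i) => β) ∘ (fun ω p => X p ω) =
      fun ω i j => X ⟨i, j⟩ ω := by
    ext; simp [Sigma.curry]
  rw [iIndepFun_iff_map_fun_eq_infinitePi_map (by fun_prop), ← hcomp,
    ← Measure.map_map (by fun_prop) (by fun_prop),
    (iIndepFun_iff_map_fun_eq_infinitePi_map (by fun_prop)).1 h,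
    Measure.infinitePi_map_piCurry (fun i j => μ.map (X ⟨i, j⟩))]
  congr 1
  funext i
  rw [(iIndepFun_iff_map_fun_eq_infinitePi_map (by fun_prop)).1 (hsub i)]

/-- The average over the index set `S` of the centered values. -/
noncomputable def centeredMean {m : ℕ} (μ : Measure Ω) (S : Finset (Fin m)) (g : Fin m → Ω → ℝ)
    (ω : Ω) : ℝ :=
  (S.card : ℝ)⁻¹ * ∑ j ∈ S, (g j ω - ∫ ω', g j ω' ∂μ)

lemma measurable_centeredMean {m : ℕ} (S : Finset (Fin m)) {g : Fin m → Ω → ℝ}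
    (hg : ∀ j, Measurable (g j)) : Measurable (centeredMean μ S g) :=
  (Finset.measurable_fun_sum _ fun j _ => (hg j).sub_const _).const_mul _

/-- Averaging divides the proxy by `S.card`. The factor `3` covers `⌊m/2⌋ ≥ m/3` for `m ≥ 2`, with
equality at `m = 3`. -/
lemma hasSubgaussianMGF_centeredMean {m : ℕ} {S : Finset (Fin m)} {g : Fin m → Ω → ℝ}
    (hind : iIndepFun g μ) {c V : ℝ≥0}
    (hg : ∀ j, HasSubgaussianMGF (fun ω => g j ω - ∫ ω', g j ω' ∂μ) c μ)
    (hm : 0 < m) (hS : m ≤ 3 * S.card) (hV : 3 * c ≤ V) :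
    HasSubgaussianMGF (centeredMean μ S g) (V / m) μ := by
  refine hasSubgaussianMGF_const_mul (HasSubgaussianMGF.sum_of_iIndepFun (s := S)
    (hind.comp (fun j z => z - ∫ ω', g j ω' ∂μ) fun j => by fun_prop) (fun j _ => hg j)) ?_
  have hSpos : 0 < S.card := by omega
  rw [NNReal.coe_div, NNReal.coe_natCast, Finset.sum_const, nsmul_eq_mul, NNReal.coe_mul, NNReal.coe_natCast]
  have h2 : ((S.card : ℝ)⁻¹) ^ 2 * (S.card * c) = c / S.card := by field_simp
  rw [h2, div_le_div_iff₀ (by positivity) (by positivity)]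
  have h3 : (m : ℝ) ≤ 3 * S.card := by exact_mod_cast hS
  have h4 : 3 * (c : ℝ) ≤ V := by exact_mod_cast hV
  calc (c : ℝ) * m ≤ c * (3 * S.card) := by gcongr
    _ = 3 * c * S.card := by ring
    _ ≤ V * S.card := by gcongr

variable {E : Type*} [NormedAddCommGroup E] [InnerProductSpace ℝ E] [MeasurableSpace E]
  [BorelSpace E] [SecondCountableTopology E] {M : ℕ} {n : Fin M → ℕ}
  {X : ((i : Fin M) × Fin (n i)) → Ω → E} {c V : ℝ≥0} {u v : E} {S S' : ∀ i, Finset (Fin (n i))}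

lemma iIndepFun_inner_client (hind : iIndepFun X μ) (u : E) (i : Fin M) :
    iIndepFun (fun (j : Fin (n i)) ω => ⟪u, X ⟨i, j⟩ ω⟫) μ :=
  (hind.precomp (g := fun j : Fin (n i) => (⟨i, j⟩ : (i : Fin M) × Fin (n i)))
    fun a b h => by simpa using h).comp (fun _ z => ⟪u, z⟫) fun _ => by fun_prop

/-- The weight `n i * β i` turns the proxy `V / n i` into `V * n i * β i ^ 2`; these add up to at
most `V * G` over the independent clients. -/
lemma measure_linear_ge_le (hX : ∀ p, Measurable (X p)) (hind : iIndepFun X μ)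
    (hsub : ∀ p, HasSubgaussianMGF (fun ω => ⟪u, X p ω⟫ - ∫ ω', ⟪u, X p ω'⟫ ∂μ) c μ)
    (hn : ∀ i, 0 < n i) (hS : ∀ i, n i ≤ 3 * (S i).card) (hV : 3 * c ≤ V) (hV0 : 0 < V)
    {β : Fin M → ℝ} {G τ : ℝ} (hG : 0 < G) (hβ : ∑ i, n i * β i ^ 2 ≤ G) (hτ : 0 ≤ τ) :
    μ {ω | √(2 * (V * G) * τ) ≤
        ∑ i, n i * (β i * centeredMean μ (S i) (fun j ω => ⟪u, X ⟨i, j⟩ ω⟫) ω)} ≤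
      ENNReal.ofReal (Real.exp (-τ)) := by
  have := hind.isProbabilityMeasure
  have hi : iIndepFun (fun i ω =>
      n i * (β i * centeredMean μ (S i) (fun j ω => ⟪u, X ⟨i, j⟩ ω⟫) ω)) μ :=
    (iIndepFun_curry hX hind).comp (fun i z => n i * (β i * ((S i).card : ℝ)⁻¹ *
      ∑ j ∈ S i, (⟪u, z j⟫ - ∫ ω', ⟪u, X ⟨i, j⟩ ω'⟫ ∂μ))) (fun i => by fun_prop) |>.congr
        fun i => ae_of_all _ fun ω => by simp only [Function.comp, centeredMean]; ring
  have hg : ∀ i ∈ Finset.univ, HasSubgaussianMGF (fun ω =>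
      n i * (β i * centeredMean μ (S i) (fun j ω => ⟪u, X ⟨i, j⟩ ω⟫) ω))
      (V * (n i * (‖β i‖₊ ^ 2))) μ := fun i _ => by
    have h1 := hasSubgaussianMGF_const_mul (r := n i * β i)
      (w := V * (n i * (‖β i‖₊ ^ 2))) (hasSubgaussianMGF_centeredMean
        (iIndepFun_inner_client hind u i) (fun j => hsub ⟨i, j⟩) (hn i) (hS i) hV) (le_of_eq ?_)
    · simpa only [mul_assoc] using h1
    · have := (Nat.cast_pos (α := ℝ)).2 (hn i)
      simp only [NNReal.coe_mul, NNReal.coe_div, NNReal.coe_natCast, NNReal.coe_pow, coe_nnnorm,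
        Real.norm_eq_abs, sq_abs]
      field_simp
  refine measure_ge_le_of_hasSubgaussianMGF (HasSubgaussianMGF.sum_of_iIndepFun hi hg) ?_
    (by positivity) hτ
  rw [NNReal.coe_sum]
  simp only [NNReal.coe_mul, NNReal.coe_natCast, NNReal.coe_pow, coe_nnnorm,
      Real.norm_eq_abs, sq_abs]
  rw [← Finset.mul_sum]
  gcongr

/-- Disjoint halves make the two averages independent, so their product is sub-exponential at scale
`V / n i`. The weight `n i` cancels this exactly: all `M` summands have scale `V`, whatever the
sample sizes. -/
lemma measure_bilinear_ge_le (hX : ∀ p, Measurable (X p)) (hind : iIndepFun X μ)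
    (hsub : ∀ p, HasSubgaussianMGF (fun ω => ⟪u, X p ω⟫ - ∫ ω', ⟪u, X p ω'⟫ ∂μ) c μ)
    (hsub' : ∀ p, HasSubgaussianMGF (fun ω => ⟪v, X p ω⟫ - ∫ ω', ⟪v, X p ω'⟫ ∂μ) c μ)
    (hn : ∀ i, 0 < n i) (hS : ∀ i, n i ≤ 3 * (S i).card) (hS' : ∀ i, n i ≤ 3 * (S' i).card)
    (hdisj : ∀ i, Disjoint (S i) (S' i)) (hV : 3 * c ≤ V) (hV0 : 0 < V) {τ : ℝ} (hτ : 0 < τ) :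
    μ {ω | 4 * V * (√(M * τ) + τ) ≤
        ∑ i, n i * (centeredMean μ (S i) (fun j ω => ⟪u, X ⟨i, j⟩ ω⟫) ω *
          centeredMean μ (S' i) (fun j ω => ⟪v, X ⟨i, j⟩ ω⟫) ω)} ≤
      ENNReal.ofReal (Real.exp (-τ)) := by
  have := hind.isProbabilityMeasure
  have hmA : ∀ i, Measurable (centeredMean μ (S i) fun j ω => ⟪u, X ⟨i, j⟩ ω⟫) := fun i =>
    measurable_centeredMean _ fun j => by have := hX ⟨i, j⟩; fun_prop
  have hmB : ∀ i, Measurable (centeredMean μ (S' i) fun j ω => ⟪v, X ⟨i, j⟩ ω⟫) := fun i =>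
    measurable_centeredMean _ fun j => by have := hX ⟨i, j⟩; fun_prop
  have hi : iIndepFun (fun i ω => n i * (centeredMean μ (S i) (fun j ω => ⟪u, X ⟨i, j⟩ ω⟫) ω *
      centeredMean μ (S' i) (fun j ω => ⟪v, X ⟨i, j⟩ ω⟫) ω)) μ :=
    (iIndepFun_curry hX hind).comp (fun i z => n i *
      ((((S i).card : ℝ)⁻¹ * ∑ j ∈ S i, (⟪u, z j⟫ - ∫ ω', ⟪u, X ⟨i, j⟩ ω'⟫ ∂μ)) *
        (((S' i).card : ℝ)⁻¹ * ∑ j ∈ S' i, (⟪v, z j⟫ - ∫ ω', ⟪v, X ⟨i, j⟩ ω'⟫ ∂μ))))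
      fun i => by fun_prop
  have hAB : ∀ i, IndepFun (centeredMean μ (S i) fun j ω => ⟪u, X ⟨i, j⟩ ω⟫)
      (centeredMean μ (S' i) fun j ω => ⟪v, X ⟨i, j⟩ ω⟫) μ := fun i => by
    have h1 : iIndepFun (fun (j : Fin (n i)) ω => X ⟨i, j⟩ ω) μ :=
      hind.precomp (g := fun j : Fin (n i) => (⟨i, j⟩ : (i : Fin M) × Fin (n i)))
        fun a b h => by simpa using h
    have h2 := (h1.indepFun_finset (S i) (S' i) (hdisj i) fun j => hX ⟨i, j⟩).comp
      (φ := fun z => ((S i).card : ℝ)⁻¹ *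
        ∑ j : S i, (⟪u, z j⟫ - ∫ ω', ⟪u, X ⟨i, j⟩ ω'⟫ ∂μ))
      (ψ := fun z => ((S' i).card : ℝ)⁻¹ *
        ∑ j : S' i, (⟪v, z j⟫ - ∫ ω', ⟪v, X ⟨i, j⟩ ω'⟫ ∂μ)) (by fun_prop) (by fun_prop)
    refine h2.congr (ae_of_all _ fun ω => ?_) (ae_of_all _ fun ω => ?_)
    · simp only [Function.comp, centeredMean]
      rw [Finset.sum_coe_sort (S i) fun j => ⟪u, X ⟨i, j⟩ ω⟫ - ∫ ω', ⟪u, X ⟨i, j⟩ ω'⟫ ∂μ]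
    · simp only [Function.comp, centeredMean]
      rw [Finset.sum_coe_sort (S' i) fun j => ⟪v, X ⟨i, j⟩ ω⟫ - ∫ ω', ⟪v, X ⟨i, j⟩ ω'⟫ ∂μ]
  have h := measure_sum_ge_le_of_subexponential hi
    (fun i => ((hmA i).mul (hmB i)).const_mul _) (V := V) (by exact_mod_cast hV0) hτ
    fun i s hs => by
      have hni := (Nat.cast_pos (α := ℝ)).2 (hn i)
      have h1 : (s * n i) ^ 2 * (((V / n i : ℝ≥0) : ℝ) * ((V / n i : ℝ≥0) : ℝ)) =
          s ^ 2 * V ^ 2 := by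
        rw [NNReal.coe_div, NNReal.coe_natCast]
        field_simp
      have h2 := lintegral_exp_mul_mul_le (hmA i) (hmB i)
        (hasSubgaussianMGF_centeredMean (iIndepFun_inner_client hind u i)
          (fun j => hsub ⟨i, j⟩) (hn i) (hS i) hV)
        (hasSubgaussianMGF_centeredMean (iIndepFun_inner_client hind v i)
          (fun j => hsub' ⟨i, j⟩) (hn i) (hS' i) hV) (hAB i) (s := s * n i) (by rwa [h1])
      rw [h1] at h2
      simpa only [mul_assoc] using h2
  simpa using h

end Concentration

/-! ### The operator norm of the deviation -/

section Operator

open scoped RealInnerProductSpace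

variable {d M : ℕ}

lemma inner_toEuclideanLin_sum_vecMulVec {ι : Type*} [Fintype ι] (w : ι → ℝ)
    (a b : ι → EuclideanSpace ℝ (Fin d)) (u v : EuclideanSpace ℝ (Fin d)) :
    ⟪u, Matrix.toEuclideanLin (∑ i, w i • Matrix.vecMulVec (a i).ofLp (b i).ofLp) v⟫ =
      ∑ i, w i * (⟪u, a i⟫ * ⟪v, b i⟫) := by
  rw [map_sum, LinearMap.sum_apply, inner_sum]
  refine Finset.sum_congr rfl fun i _ => ?_
  rw [map_smul, LinearMap.smul_apply, real_inner_smul_right]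
  congr 1
  have h : Matrix.toEuclideanLin (Matrix.vecMulVec (a i).ofLp (b i).ofLp) v = ⟪v, b i⟫ • a i := by
    ext r
    simp only [Matrix.toLpLin_apply, Matrix.vecMulVec_mulVec, PiLp.smul_apply, Pi.smul_apply,
      PiLp.inner_apply, RCLike.inner_apply, conj_trivial, dotProduct, smul_eq_mul,
      MulOpposite.smul_eq_mul_unop, MulOpposite.unop_op]
    ring
  rw [h, real_inner_smul_right, mul_comm]

variable {Ω : Type*} [MeasurableSpace Ω] {μ : Measure Ω} {n : Fin M → ℕ}

/-- The average of the vectors `X_j` over `j ∈ S`. -/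
noncomputable def vectorMean {m : ℕ} (S : Finset (Fin m)) (X : Fin m → EuclideanSpace ℝ (Fin d)) :
    EuclideanSpace ℝ (Fin d) :=
  (S.card : ℝ)⁻¹ • ∑ j ∈ S, X j

lemma inner_vectorMean {m : ℕ} (S : Finset (Fin m)) (X : Fin m → Ω → EuclideanSpace ℝ (Fin d))
    (u : EuclideanSpace ℝ (Fin d)) (ω : Ω) :
    ⟪u, vectorMean S fun j => X j ω⟫ = centeredMean μ S (fun j ω => ⟪u, X j ω⟫) ω +
      (S.card : ℝ)⁻¹ * ∑ j ∈ S, ∫ ω', ⟪u, X j ω'⟫ ∂μ := by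
  rw [vectorMean, centeredMean, real_inner_smul_right, inner_sum, ← mul_add,
    ← Finset.sum_add_distrib]
  simp

lemma abs_average_sub_le {m : ℕ} {S : Finset (Fin m)} (hS : 0 < S.card) {f : Fin m → ℝ} {p ε : ℝ}
    (h : ∀ j, |f j - p| ≤ ε) : |(S.card : ℝ)⁻¹ * ∑ j ∈ S, f j - p| ≤ ε := by
  have hS' : (0 : ℝ) < S.card := by exact_mod_cast hS
  have h1 : (S.card : ℝ)⁻¹ * ∑ j ∈ S, f j - p = (S.card : ℝ)⁻¹ * ∑ j ∈ S, (f j - p) := by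
    rw [Finset.sum_sub_distrib, Finset.sum_const, nsmul_eq_mul]
    field_simp
  rw [h1, abs_mul, abs_of_pos (inv_pos.2 hS'), inv_mul_le_iff₀ hS']
  refine (Finset.abs_sum_le_sum_abs _ _).trans ((Finset.sum_le_sum fun j _ => h j).trans ?_)
  rw [Finset.sum_const, nsmul_eq_mul]

variable {X : ((i : Fin M) × Fin (n i)) → Ω → EuclideanSpace ℝ (Fin d)} {c V : ℝ≥0}
  {S S' : ∀ i, Finset (Fin (n i))} {z : Fin M → EuclideanSpace ℝ (Fin d)}

/-- The deviation level of the bilinear forms. -/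
noncomputable def deviationLevel (M N : ℕ) (V G τ A ε : ℝ) : ℝ :=
  4 * V * (√(M * τ) + τ) + 2 * √(2 * (V * G) * τ) + N * (ε * (2 * A + ε))

/-- With centered parts `a, b` and means `p, q`, expand `(a + p) (b + q) = a b + q a + p b + p q`.
The first three sums each fail with probability at most `exp (-τ)`; `p q` is deterministic and close
to `⟪u, z⟫ ⟪v, z⟫`. -/
lemma measure_form_ge_le (hX : ∀ p, Measurable (X p)) (hind : iIndepFun X μ)
    (hsub : ∀ u : EuclideanSpace ℝ (Fin d), ‖u‖ = 1 → ∀ p,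
      HasSubgaussianMGF (fun ω => ⟪u, X p ω⟫ - ∫ ω', ⟪u, X p ω'⟫ ∂μ) c μ)
    (hn : ∀ i, 0 < n i) (hS : ∀ i, n i ≤ 3 * (S i).card) (hS' : ∀ i, n i ≤ 3 * (S' i).card)
    (hdisj : ∀ i, Disjoint (S i) (S' i)) (hV : 3 * c ≤ V) (hV0 : 0 < V)
    {G τ A ε : ℝ} (hG : 0 < G) (hτ : 0 < τ) (hz : ∀ i, ‖z i‖ ≤ A) (hε : 0 ≤ ε)
    (hbias : ∀ u : EuclideanSpace ℝ (Fin d), ‖u‖ = 1 → ∀ p,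
      |∫ ω', ⟪u, X p ω'⟫ ∂μ - ⟪u, z p.1⟫| ≤ ε)
    (hvar : ∀ u : EuclideanSpace ℝ (Fin d), ‖u‖ = 1 →
      2 * ∑ i, n i * ⟪u, z i⟫ ^ 2 + 2 * (totalSamples n * ε ^ 2) ≤ G)
    {u v : EuclideanSpace ℝ (Fin d)} (hu : ‖u‖ = 1) (hv : ‖v‖ = 1) :
    μ {ω | deviationLevel M (totalSamples n) V G τ A ε < ⟪u, Matrix.toEuclideanLin
        (∑ i, (n i : ℝ) • Matrix.vecMulVec (vectorMean (S i) fun j => X ⟨i, j⟩ ω).ofLp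
            (vectorMean (S' i) fun j => X ⟨i, j⟩ ω).ofLp -
          ∑ i, (n i : ℝ) • Matrix.vecMulVec (z i).ofLp (z i).ofLp) v⟫} ≤
      3 * ENNReal.ofReal (Real.exp (-τ)) := by
  have hSpos : ∀ i, 0 < (S i).card := fun i => by have := hn i; have := hS i; omega
  have hSpos' : ∀ i, 0 < (S' i).card := fun i => by have := hn i; have := hS' i; omega
  let a := fun i => centeredMean μ (S i) fun j ω => ⟪u, X ⟨i, j⟩ ω⟫
  let b := fun i => centeredMean μ (S' i) fun j ω => ⟪v, X ⟨i, j⟩ ω⟫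
  let p := fun i => ((S i).card : ℝ)⁻¹ * ∑ j ∈ S i, ∫ ω', ⟪u, X ⟨i, j⟩ ω'⟫ ∂μ
  let q := fun i => ((S' i).card : ℝ)⁻¹ * ∑ j ∈ S' i, ∫ ω', ⟪v, X ⟨i, j⟩ ω'⟫ ∂μ
  have hp : ∀ i, |p i - ⟪u, z i⟫| ≤ ε := fun i =>
    abs_average_sub_le (hSpos i) fun j => hbias u hu ⟨i, j⟩
  have hq : ∀ i, |q i - ⟪v, z i⟫| ≤ ε := fun i =>
    abs_average_sub_le (hSpos' i) fun j => hbias v hv ⟨i, j⟩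
  have hsq : ∀ {r s : ℝ}, |r - s| ≤ ε → r ^ 2 ≤ 2 * s ^ 2 + 2 * ε ^ 2 := fun {r s} h => by
    have h1 := sq_le_sq' (abs_le.1 h).1 (abs_le.1 h).2
    nlinarith [sq_nonneg (r - 2 * s)]
  have hsum : ∀ {r : Fin M → ℝ} {w : EuclideanSpace ℝ (Fin d)}, ‖w‖ = 1 →
      (∀ i, |r i - ⟪w, z i⟫| ≤ ε) → ∑ i, n i * r i ^ 2 ≤ G := fun {r w} hw h => by
    refine le_trans ?_ (hvar w hw)
    rw [totalSamples, Nat.cast_sum, Finset.sum_mul, Finset.mul_sum, Finset.mul_sum,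
      ← Finset.sum_add_distrib]
    refine Finset.sum_le_sum fun i _ => ?_
    calc (n i : ℝ) * r i ^ 2 ≤ n i * (2 * ⟪w, z i⟫ ^ 2 + 2 * ε ^ 2) := by
          gcongr; exact hsq (h i)
      _ = _ := by ring
  have hdet : ∀ i, p i * q i - ⟪u, z i⟫ * ⟪v, z i⟫ ≤ ε * (2 * A + ε) := fun i => by
    have h1 : |⟪u, z i⟫| ≤ A := (abs_real_inner_le_norm _ _).trans (by rw [hu, one_mul]; exact hz i)
    have h2 : |⟪v, z i⟫| ≤ A := (abs_real_inner_le_norm _ _).trans (by rw [hv, one_mul]; exact hz i)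
    have h3 : p i * q i - ⟪u, z i⟫ * ⟪v, z i⟫ = (p i - ⟪u, z i⟫) * (q i - ⟪v, z i⟫) +
        (p i - ⟪u, z i⟫) * ⟪v, z i⟫ + ⟪u, z i⟫ * (q i - ⟪v, z i⟫) := by ring
    rw [h3]
    have h4 : (p i - ⟪u, z i⟫) * (q i - ⟪v, z i⟫) ≤ ε * ε :=
      (le_abs_self _).trans (by rw [abs_mul]; gcongr; exacts [hp i, hq i])
    have h5 : (p i - ⟪u, z i⟫) * ⟪v, z i⟫ ≤ ε * A :=
      (le_abs_self _).trans (by rw [abs_mul]; gcongr; exact hp i)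
    have h6 : ⟪u, z i⟫ * (q i - ⟪v, z i⟫) ≤ A * ε :=
      (le_abs_self _).trans (by
        rw [abs_mul]; gcongr; exacts [(abs_nonneg _).trans h1, hq i])
    linarith
  have hform : ∀ ω, ⟪u, Matrix.toEuclideanLin
        (∑ i, (n i : ℝ) • Matrix.vecMulVec (vectorMean (S i) fun j => X ⟨i, j⟩ ω).ofLp
            (vectorMean (S' i) fun j => X ⟨i, j⟩ ω).ofLp -
          ∑ i, (n i : ℝ) • Matrix.vecMulVec (z i).ofLp (z i).ofLp) v⟫ ≤
      ∑ i, n i * (a i ω * b i ω) + ∑ i, n i * (q i * a i ω) + ∑ i, n i * (p i * b i ω) +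
        totalSamples n * (ε * (2 * A + ε)) := fun ω => by
    rw [map_sub, LinearMap.sub_apply, inner_sub_right, inner_toEuclideanLin_sum_vecMulVec,
      inner_toEuclideanLin_sum_vecMulVec, totalSamples, Nat.cast_sum, Finset.sum_mul,
      ← Finset.sum_sub_distrib, ← Finset.sum_add_distrib, ← Finset.sum_add_distrib,
      ← Finset.sum_add_distrib]
    refine Finset.sum_le_sum fun i _ => ?_
    rw [inner_vectorMean (μ := μ) (S i) (fun j => X ⟨i, j⟩),
      inner_vectorMean (μ := μ) (S' i) (fun j => X ⟨i, j⟩)]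
    have h1 := mul_le_mul_of_nonneg_left (hdet i) (Nat.cast_nonneg (α := ℝ) (n i))
    simp only [a, b, p, q] at h1 ⊢
    linarith
  have hE1 := measure_bilinear_ge_le hX hind (hsub u hu) (hsub v hv) hn hS hS' hdisj hV hV0 hτ
  have hE2 := measure_linear_ge_le hX hind (hsub u hu) hn hS hV hV0 hG (hsum hv hq) hτ.le
  have hE3 := measure_linear_ge_le hX hind (hsub v hv) hn hS' hV hV0 hG (hsum hu hp) hτ.le
  refine (measure_mono (t := _ ∪ _ ∪ _) fun ω hω => ?_).trans ((measure_union_le _ _).trans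
    (add_le_add ((measure_union_le _ _).trans (add_le_add hE1 hE2)) hE3)) |>.trans
      (le_of_eq (by ring))
  by_contra hcon
  simp only [Set.mem_union, Set.mem_ofPred_eq, not_or, not_le] at hcon hω
  have h1 := hform ω
  simp only [deviationLevel] at hω
  simp only [a, b] at h1
  linarith [hcon.1.1, hcon.1.2, hcon.2]

lemma measure_norm_gt_le (hX : ∀ p, Measurable (X p)) (hind : iIndepFun X μ)
    (hsub : ∀ u : EuclideanSpace ℝ (Fin d), ‖u‖ = 1 → ∀ p,
      HasSubgaussianMGF (fun ω => ⟪u, X p ω⟫ - ∫ ω', ⟪u, X p ω'⟫ ∂μ) c μ)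
    (hn : ∀ i, 0 < n i) (hS : ∀ i, n i ≤ 3 * (S i).card) (hS' : ∀ i, n i ≤ 3 * (S' i).card)
    (hdisj : ∀ i, Disjoint (S i) (S' i)) (hV : 3 * c ≤ V) (hV0 : 0 < V)
    {G τ A ε : ℝ} (hG : 0 < G) (hτ : 0 < τ) (hA : 0 ≤ A) (hz : ∀ i, ‖z i‖ ≤ A) (hε : 0 ≤ ε)
    (hbias : ∀ u : EuclideanSpace ℝ (Fin d), ‖u‖ = 1 → ∀ p,
      |∫ ω', ⟪u, X p ω'⟫ ∂μ - ⟪u, z p.1⟫| ≤ ε)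
    (hvar : ∀ u : EuclideanSpace ℝ (Fin d), ‖u‖ = 1 →
      2 * ∑ i, n i * ⟪u, z i⟫ ^ 2 + 2 * (totalSamples n * ε ^ 2) ≤ G) :
    μ {ω | ¬ ∀ x, ‖Matrix.toEuclideanLin
        (∑ i, (n i : ℝ) • Matrix.vecMulVec (vectorMean (S i) fun j => X ⟨i, j⟩ ω).ofLp
            (vectorMean (S' i) fun j => X ⟨i, j⟩ ω).ofLp -
          ∑ i, (n i : ℝ) • Matrix.vecMulVec (z i).ofLp (z i).ofLp) x‖ ≤
        4 * deviationLevel M (totalSamples n) V G τ A ε * ‖x‖} ≤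
      ENNReal.ofReal (3 * 25 ^ d * Real.exp (-τ)) := by
  obtain ⟨Nt, hN1, hNc, hN⟩ := exists_half_net (EuclideanSpace ℝ (Fin d))
  rw [finrank_euclideanSpace_fin] at hNc
  have hdev : 0 ≤ deviationLevel M (totalSamples n) V G τ A ε := by
    unfold deviationLevel; positivity
  let bad : EuclideanSpace ℝ (Fin d) × EuclideanSpace ℝ (Fin d) → Set Ω := fun uv =>
    {ω | deviationLevel M (totalSamples n) V G τ A ε < ⟪uv.1, Matrix.toEuclideanLin
        (∑ i, (n i : ℝ) • Matrix.vecMulVec (vectorMean (S i) fun j => X ⟨i, j⟩ ω).ofLp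
            (vectorMean (S' i) fun j => X ⟨i, j⟩ ω).ofLp -
          ∑ i, (n i : ℝ) • Matrix.vecMulVec (z i).ofLp (z i).ofLp) uv.2⟫}
  have hcover : {ω | ¬ ∀ x, ‖Matrix.toEuclideanLin
        (∑ i, (n i : ℝ) • Matrix.vecMulVec (vectorMean (S i) fun j => X ⟨i, j⟩ ω).ofLp
            (vectorMean (S' i) fun j => X ⟨i, j⟩ ω).ofLp -
          ∑ i, (n i : ℝ) • Matrix.vecMulVec (z i).ofLp (z i).ofLp) x‖ ≤
        4 * deviationLevel M (totalSamples n) V G τ A ε * ‖x‖} ⊆ ⋃ uv ∈ Nt ×ˢ Nt, bad uv := by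
    intro ω hω
    by_contra hcon
    refine hω (norm_le_of_half_net hN _ hdev fun u hu v hv => ?_)
    by_contra! h
    exact hcon (Set.mem_biUnion (x := (u, v)) (by simp [hu, hv]) h)
  refine (measure_mono hcover).trans ((measure_biUnion_finset_le _ _).trans ?_)
  calc _ ≤ ∑ _uv ∈ Nt ×ˢ Nt, 3 * ENNReal.ofReal (Real.exp (-τ)) :=
        Finset.sum_le_sum fun uv huv => by
          rw [Finset.mem_product] at huv
          exact measure_form_ge_le hX hind hsub hn hS hS' hdisj hV hV0 hG hτ hz hε hbias hvar
            (hN1 _ huv.1) (hN1 _ huv.2)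
    _ = ENNReal.ofReal ((Nt.card * Nt.card : ℕ) * (3 * Real.exp (-τ))) := by
        rw [Finset.sum_const, Finset.card_product, nsmul_eq_mul,
          ENNReal.ofReal_mul (Nat.cast_nonneg _), ENNReal.ofReal_natCast,
          ENNReal.ofReal_mul (by norm_num)]
        norm_num
    _ ≤ _ := by
        refine ENNReal.ofReal_le_ofReal ?_
        have h1 : ((Nt.card * Nt.card : ℕ) : ℝ) ≤ 25 ^ d := by
          have h2 : Nt.card * Nt.card ≤ 5 ^ d * 5 ^ d := Nat.mul_le_mul hNc hNc
          rw [← mul_pow] at h2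
          exact_mod_cast h2
        calc _ ≤ 25 ^ d * (3 * Real.exp (-τ)) := by gcongr
          _ = _ := by ring

end Operator

/-! ### The estimator in the well-represented case -/

section Main

open scoped RealInnerProductSpace

lemma eigenvalueDesc_nonneg {m : ℕ} {A : Matrix (Fin m) (Fin m) ℝ}
    (h : ∀ x, 0 ≤ ⟪x, Matrix.toEuclideanLin A x⟫) (r : ℕ) : 0 ≤ eigenvalueDesc A r := by
  unfold eigenvalueDesc
  split_ifs with hA
  · have hS := Matrix.isSymmetric_toEuclideanLin_iff.mpr hA.1
    set j : Fin (Fintype.card (Fin m)) := ⟨r - 1, _⟩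
    have h1 := h (hS.eigenvectorBasis finrank_euclideanSpace j)
    rw [hS.apply_eigenvectorBasis, real_inner_smul_right, real_inner_self_eq_norm_sq,
      OrthonormalBasis.norm_eq_one] at h1
    simpa [Matrix.IsHermitian.eigenvalues₀] using h1
  · exact le_rfl

lemma isHermitian_of_transpose_eq {m : ℕ} {A : Matrix (Fin m) (Fin m) ℝ} (h : Aᵀ = A) :
    A.IsHermitian := by
  rw [Matrix.IsHermitian, Matrix.conjTranspose_eq_transpose_of_trivial, h]

/-- Conditioning and scale give `c₀ ≤ κ λ_d`, so the covariance is bounded below. Positive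
semidefiniteness excludes `κ < 0`, which would force `λ₁ ≤ 0`. -/
lemma norm_regression_le {Ω : Type*} [MeasurableSpace Ω] {μ : Measure Ω} [IsProbabilityMeasure μ]
    {d : ℕ} {x : Ω → EuclideanSpace ℝ (Fin d)} {γ2 : ℝ≥0} (hx : IsSubGaussianVector μ x γ2)
    (h0 : ∫ ω, x ω ∂μ = 0) {κ c₀ a : ℝ} (hc₀ : 0 < c₀)
    (hcond : eigenvalueDesc (secondMoment μ x) 1 ≤ κ * eigenvalueDesc (secondMoment μ x) d)
    (hscale : c₀ ≤ eigenvalueDesc (secondMoment μ x) 1) {θ : EuclideanSpace ℝ (Fin d)}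
    (ha : ‖Matrix.toEuclideanLin (secondMoment μ x) θ‖ ≤ a) : ‖θ‖ ≤ κ * a / c₀ := by
  have hH : (secondMoment μ x).IsHermitian := isHermitian_of_transpose_eq (by
    ext i j
    simp only [Matrix.transpose_apply, secondMoment, Matrix.of_apply, mul_comm])
  have hpsd : ∀ v, 0 ≤ ⟪v, Matrix.toEuclideanLin (secondMoment μ x) v⟫ := fun v => by
    rw [← integral_inner_mul_inner hx h0]
    refine integral_nonneg fun ω => ?_
    simp only [Pi.zero_apply]
    rw [real_inner_comm]
    exact mul_self_nonneg _
  have hd := eigenvalueDesc_nonneg hpsd d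
  have hκ : 0 ≤ κ := by
    by_contra! hneg
    nlinarith
  have h1 := norm_le_of_quadratic_form θ (eigenvalueDesc_last_mul_le hH θ)
  rw [le_div_iff₀ hc₀]
  calc ‖θ‖ * c₀ ≤ ‖θ‖ * (κ * eigenvalueDesc (secondMoment μ x) d) := by
        gcongr; exact hscale.trans hcond
    _ = κ * (eigenvalueDesc (secondMoment μ x) d * ‖θ‖) := by ring
    _ ≤ κ * a := by gcongr; exact h1.trans ha

/-- With `q = √(dN/k)` and `r = √(Md)`, the target is a multiple of `(q + r) l³`. The Bernstein term
uses `τ ≤ 14 d l` and `d ≤ q`, the latter being where `d k ≤ N` is needed; its factors `l²` from `V`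
and `l` from `τ` make the cube. -/
lemma deviationLevel_le {M d k N : ℕ} (hk : 1 ≤ k) (hd : 1 ≤ d) (hN : d * k ≤ N) {l g c₂ b A ε : ℝ}
    (hl : 1 ≤ l) (hg : 0 ≤ g) (hA : 0 ≤ A) (hb : 0 ≤ b) (hε : 0 ≤ ε)
    (hεb : N * ε ≤ b) :
    deviationLevel M N (726 * l ^ 2 * g) (2 * N * (c₂ + b ^ 2) / k) (4 * d + 10 * l) A ε ≤
      (52272 * g + 404 * √(g * (c₂ + b ^ 2)) + b * (2 * A + b)) *
        (N / k * ((√((d : ℝ) * k / N) + √((M : ℝ) * d * (k : ℝ) ^ 2 / (N : ℝ) ^ 2)) * l ^ 3)) := by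
  have hk' : (1 : ℝ) ≤ k := by exact_mod_cast hk
  have hd' : (1 : ℝ) ≤ d := by exact_mod_cast hd
  have hN' : (d : ℝ) * k ≤ N := by exact_mod_cast hN
  have hN1 : (1 : ℝ) ≤ N := by nlinarith
  have hk0 : (0 : ℝ) < k := by linarith
  have hN0 : (0 : ℝ) < N := by linarith
  have hl0 : 0 < l := by linarith
  set q := √((d : ℝ) * N / k) with hq
  set r := √((M : ℝ) * d) with hr
  have hq2 : q ^ 2 = (d : ℝ) * N / k := Real.sq_sqrt (by positivity)
  have hr2 : r ^ 2 = (M : ℝ) * d := Real.sq_sqrt (by positivity)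
  have hq0 : 0 ≤ q := Real.sqrt_nonneg _
  have hr0 : 0 ≤ r := Real.sqrt_nonneg _
  have hrate : (N : ℝ) / k * ((√((d : ℝ) * k / N) +
      √((M : ℝ) * d * (k : ℝ) ^ 2 / (N : ℝ) ^ 2)) * l ^ 3) = (q + r) * l ^ 3 := by
    have h1 : (N : ℝ) / k * √((d : ℝ) * k / N) = q := by
      rw [hq, ← Real.sqrt_sq (show (0 : ℝ) ≤ N / k by positivity), ← Real.sqrt_mul (by positivity)]
      congr 1
      field_simp
    have h2 : (N : ℝ) / k * √((M : ℝ) * d * (k : ℝ) ^ 2 / (N : ℝ) ^ 2) = r := by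
      rw [hr, ← Real.sqrt_sq (show (0 : ℝ) ≤ N / k by positivity), ← Real.sqrt_mul (by positivity)]
      congr 1
      field_simp
    rw [← mul_assoc, mul_add, h1, h2]
  rw [hrate]
  have hdq : (d : ℝ) ≤ q := by
    refine Real.le_sqrt_of_sq_le ?_
    rw [le_div_iff₀ hk0]
    nlinarith
  have hτ : 4 * (d : ℝ) + 10 * l ≤ 14 * (d * l) := by nlinarith
  have hl2 : l ≤ l ^ 2 := by nlinarith
  have hl3 : l ^ 2 ≤ l ^ 3 := by nlinarith [sq_nonneg l]
  have hl31 : 1 ≤ l ^ 3 := one_le_pow₀ hl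
  have h1 : √(M * (4 * d + 10 * l)) ≤ 4 * l * r := by
    refine Real.sqrt_le_iff.2 ⟨by positivity, ?_⟩
    rw [mul_pow, hr2]
    calc (M : ℝ) * (4 * d + 10 * l) ≤ M * (14 * (d * l)) := by gcongr
      _ = 14 * l * (M * d) := by ring
      _ ≤ (4 * l) ^ 2 * (M * d) := by gcongr; nlinarith
  have h2 : 4 * (726 * l ^ 2 * g) * (√(M * (4 * d + 10 * l)) + (4 * d + 10 * l)) ≤
      52272 * g * ((q + r) * l ^ 3) := by
    calc _ ≤ 4 * (726 * l ^ 2 * g) * (4 * l * r + 14 * (q * l)) := by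
          gcongr
          exact hτ.trans (by gcongr)
      _ = 2904 * g * l ^ 3 * (4 * r + 14 * q) := by ring
      _ ≤ 2904 * g * l ^ 3 * (18 * (q + r)) := by gcongr; linarith
      _ = _ := by ring
  have h3 : √(2 * (726 * l ^ 2 * g * (2 * N * (c₂ + b ^ 2) / k)) * (4 * d + 10 * l)) ≤
      202 * √(g * (c₂ + b ^ 2)) * ((q + r) * l ^ 3) := by
    -- No sign of `c₂` is assumed here; for a negative radicand both roots are `0` by convention.
    rcases le_or_gt 0 (g * (c₂ + b ^ 2)) with h0 | h0
    · refine Real.sqrt_le_iff.2 ⟨by positivity, ?_⟩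
      have h4 : 202 * √(g * (c₂ + b ^ 2)) * (q * l ^ 2) ≤
          202 * √(g * (c₂ + b ^ 2)) * ((q + r) * l ^ 3) := by
        gcongr; linarith
      refine le_trans ?_ (pow_le_pow_left₀ (by positivity) h4 2)
      have h5 : (202 * √(g * (c₂ + b ^ 2)) * (q * l ^ 2)) ^ 2 =
          40804 * (g * (c₂ + b ^ 2)) * ((d : ℝ) * N / k) * l ^ 4 := by
        rw [← hq2, mul_pow, mul_pow, Real.sq_sqrt h0]; ring
      rw [h5]
      calc _ = 2904 * (g * (c₂ + b ^ 2)) * (N / k) * l ^ 2 * (4 * d + 10 * l) := by ring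
        _ ≤ 2904 * (g * (c₂ + b ^ 2)) * (N / k) * l ^ 2 * (14 * (d * l)) := by gcongr
        _ = 40656 * (g * (c₂ + b ^ 2)) * ((d : ℝ) * N / k) * l ^ 3 := by ring
        _ ≤ 40804 * (g * (c₂ + b ^ 2)) * ((d : ℝ) * N / k) * l ^ 4 := by
            gcongr
            · norm_num
            · norm_num
    · refine (le_of_eq (Real.sqrt_eq_zero_of_nonpos ?_)).trans (by positivity)
      have h4 : 2 * (726 * l ^ 2 * g * (2 * N * (c₂ + b ^ 2) / k)) * (4 * d + 10 * l) =
          g * (c₂ + b ^ 2) * (2904 * l ^ 2 * (N / k) * (4 * d + 10 * l)) := by ring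
      rw [h4]
      exact mul_nonpos_of_nonpos_of_nonneg h0.le (by positivity)
  have hεb' : ε ≤ b := by nlinarith
  have h4 : N * (ε * (2 * A + ε)) ≤ b * (2 * A + b) * ((q + r) * l ^ 3) := by
    calc N * (ε * (2 * A + ε)) = N * ε * (2 * A + ε) := by ring
      _ ≤ b * (2 * A + b) * 1 := by rw [mul_one]; gcongr
      _ ≤ _ := by
        gcongr
        exact one_le_mul_of_one_le_of_one_le (by linarith) hl31
  unfold deviationLevel
  linarith

lemma one_le_errorRate {d k M N : ℕ} (hN : 0 < N) (h : N ≤ d * k)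
    (hl : 1 ≤ Real.log ((d : ℝ) + N)) : 1 ≤ errorRate d k M N := by
  have hN' : (0 : ℝ) < N := by exact_mod_cast hN
  have h1 : 1 ≤ √((d : ℝ) * k / N) := by
    rw [Real.one_le_sqrt, le_div_iff₀ hN', one_mul]
    exact_mod_cast h
  unfold errorRate
  refine one_le_mul_of_one_le_of_one_le ?_ (one_le_pow₀ hl)
  linarith [Real.sqrt_nonneg ((M : ℝ) * d * (k : ℝ) ^ 2 / (N : ℝ) ^ 2)]

lemma card_filter_lt_half (m : ℕ) :
    (Finset.univ.filter fun j : Fin m => (j : ℕ) < m / 2).card = m / 2 := by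
  rw [Fin.card_filter_val_lt]
  omega

lemma card_filter_ge_half (m : ℕ) :
    (Finset.univ.filter fun j : Fin m => m / 2 ≤ (j : ℕ)).card = m - m / 2 := by
  have h := Finset.card_filter_add_card_filter_not (s := (Finset.univ : Finset (Fin m)))
    (fun j : Fin m => (j : ℕ) < m / 2)
  simp only [not_lt, card_filter_lt_half, Finset.card_univ, Fintype.card_fin] at h
  omega

variable {M d k : ℕ} {n : Fin M → ℕ}

/-- The matrix `∑ i, n_i α_i α_iᵀ`. -/
noncomputable def weightedGram (n : Fin M → ℕ) (α : Fin M → EuclideanSpace ℝ (Fin k)) :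
    Matrix (Fin k) (Fin k) ℝ :=
  ∑ i, (n i : ℝ) • Matrix.vecMulVec (α i).ofLp (α i).ofLp

lemma transpose_weightedGram (n : Fin M → ℕ) (α : Fin M → EuclideanSpace ℝ (Fin k)) :
    (weightedGram n α)ᵀ = weightedGram n α := by
  simp only [weightedGram, Matrix.transpose_sum, Matrix.transpose_smul,
    Matrix.transpose_vecMulVec]

lemma isHermitian_diversityMatrix (n : Fin M → ℕ) (α : Fin M → EuclideanSpace ℝ (Fin k)) :
    (diversityMatrix n α).IsHermitian :=
  isHermitian_of_transpose_eq (by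
    change ((totalSamples n : ℝ)⁻¹ • weightedGram n α)ᵀ = (totalSamples n : ℝ)⁻¹ • weightedGram n α
    rw [Matrix.transpose_smul, transpose_weightedGram])

lemma inner_weightedGram (hN : 0 < totalSamples n) (α : Fin M → EuclideanSpace ℝ (Fin k))
    (u : EuclideanSpace ℝ (Fin k)) :
    ⟪u, Matrix.toEuclideanLin (weightedGram n α) u⟫ =
      totalSamples n * ⟪u, Matrix.toEuclideanLin (diversityMatrix n α) u⟫ := by
  have hN' : (totalSamples n : ℝ) ≠ 0 := by exact_mod_cast hN.ne'
  change _ = _ * ⟪u, Matrix.toEuclideanLin ((totalSamples n : ℝ)⁻¹ • weightedGram n α) u⟫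
  rw [map_smul, LinearMap.smul_apply, real_inner_smul_right, mul_inv_cancel_left₀ hN']

lemma mul_weightedGram_mul (B : Matrix (Fin d) (Fin k) ℝ) (n : Fin M → ℕ)
    (α : Fin M → EuclideanSpace ℝ (Fin k)) :
    B * weightedGram n α * Bᵀ =
      weightedGram n fun i => Matrix.toEuclideanLin B (α i) := by
  simp only [weightedGram, Matrix.mul_sum, Matrix.sum_mul, Matrix.mul_smul, Matrix.smul_mul,
    Matrix.mul_vecMulVec, Matrix.vecMulVec_mul, Matrix.vecMul_transpose, Matrix.toLpLin_apply]

lemma totalSamples_pos_of_eigenvalueDesc_pos {α : Fin M → EuclideanSpace ℝ (Fin k)} (hk : 1 ≤ k)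
    (h : 0 < eigenvalueDesc (diversityMatrix n α) k) : 0 < totalSamples n := by
  by_contra! h0
  have h1 : totalSamples n = 0 := by omega
  have h2 := eigenvalueDesc_last_mul_le (isHermitian_diversityMatrix n α)
    (EuclideanSpace.single ⟨0, hk⟩ 1)
  have h3 : diversityMatrix n α = 0 := by simp [diversityMatrix, h1]
  rw [h3] at h2 h
  simp at h2
  linarith

lemma estimatorMatrix_eq_of_abs_le (x : (i : Fin M) → Fin (n i) → EuclideanSpace ℝ (Fin d))
    (y : (i : Fin M) → Fin (n i) → ℝ) {L : ℝ} (h : ∀ i j, |y i j| ≤ L) :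
    estimatorMatrix x y = ∑ i, (n i : ℝ) • Matrix.vecMulVec
      (vectorMean (Finset.univ.filter fun j : Fin (n i) => (j : ℕ) < n i / 2) fun j =>
        truncatedProduct L (y i j) (x i j)).ofLp
      (vectorMean (Finset.univ.filter fun j : Fin (n i) => n i / 2 ≤ (j : ℕ)) fun j =>
        truncatedProduct L (y i j) (x i j)).ofLp := by
  simp only [estimatorMatrix, firstHalfMean, secondHalfMean, vectorMean, card_filter_lt_half,
    card_filter_ge_half, truncatedProduct_of_abs_le (h _ _)]

lemma exp_neg_mul_log {a : ℝ} (ha : 0 < a) (m : ℕ) :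
    Real.exp (-(m * Real.log a)) = (a ^ m)⁻¹ := by
  rw [Real.exp_neg, Real.exp_nat_mul, Real.exp_log ha]

/-- The summand `4 d` of the deviation parameter pays for the pairs of net points. -/
lemma twentyfive_pow_mul_exp_le (d : ℕ) : (25 : ℝ) ^ d * Real.exp (-(4 * d)) ≤ 1 := by
  have h1 : (25 : ℝ) ≤ Real.exp 4 := by
    have h2 : Real.exp 4 = Real.exp 1 ^ 4 := by rw [← Real.exp_nat_mul]; norm_num
    rw [h2]
    have h3 : (2.7 : ℝ) ^ 4 ≤ Real.exp 1 ^ 4 :=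
      pow_le_pow_left₀ (by norm_num) (by linarith [Real.exp_one_gt_d9]) 4
    norm_num at h3 ⊢
    linarith
  rw [Real.exp_neg, mul_comm (4 : ℝ), Real.exp_nat_mul, ← div_eq_mul_inv, div_le_one (by positivity)]
  gcongr

end Main

/-- The estimator inherits the operator-norm error of `Z`. -/
lemma sinThetaDist_le_of_isEstimate {M d k : ℕ} {n : Fin M → ℕ}
    {α : Fin M → EuclideanSpace ℝ (Fin k)} {x : (i : Fin M) → Fin (n i) → EuclideanSpace ℝ (Fin d)}
    {y : (i : Fin M) → Fin (n i) → ℝ} {B V : Matrix (Fin d) (Fin k) ℝ} {c₁ η : ℝ} (hk : 1 ≤ k)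
    (hc₁ : 0 < c₁) (hB : IsOrthonormalMatrix B)
    (hD : c₁ / k ≤ eigenvalueDesc (diversityMatrix n α) k) (hV : IsEstimate x y V) (hη : 0 ≤ η)
    (hZ : ∀ v, ‖Matrix.toEuclideanLin (estimatorMatrix x y -
      weightedGram n fun i => Matrix.toEuclideanLin B (α i)) v‖ ≤ η * ‖v‖) :
    sinThetaDist V B ≤ 4 * η / (totalSamples n * (c₁ / k)) := by
  have hk0 : (0 : ℝ) < k := by exact_mod_cast hk
  have hN := totalSamples_pos_of_eigenvalueDesc_pos hk ((div_pos hc₁ hk0).trans_le hD)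
  have hN0 : (0 : ℝ) < totalSamples n := by exact_mod_cast hN
  have hG : ∀ v, totalSamples n * (c₁ / k) * ‖v‖ ≤ ‖Matrix.toEuclideanLin (weightedGram n α) v‖ :=
    fun v => norm_le_of_quadratic_form v (by
      rw [inner_weightedGram hN, mul_assoc]
      gcongr
      exact (mul_le_mul_of_nonneg_right hD (sq_nonneg _)).trans
        (eigenvalueDesc_last_mul_le (isHermitian_diversityMatrix n α) v))
  rw [← mul_weightedGram_mul] at hZ
  rcases hV with hV | hV
  · exact sinThetaDist_right_le hB hV hη (by positivity) hG hZ
  · exact sinThetaDist_left_le hB (transpose_weightedGram n α) hV hη (by positivity) hG hZ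

lemma measure_iUnion_abs_gt_le {Ω ι : Type*} [MeasurableSpace Ω] {μ : Measure Ω} [Fintype ι]
    {y : ι → Ω → ℝ} {v : ℝ≥0} (hy : ∀ p, HasSubgaussianMGF (y p) v μ) (L : ℝ) :
    μ (⋃ p, {ω | L < |y p ω|}) ≤
      ENNReal.ofReal (Fintype.card ι * (Real.exp (-L) * (2 * Real.exp (v / 2)))) := by
  refine (measure_iUnion_fintype_le _ _).trans
    ((Finset.sum_le_sum fun p _ => measure_abs_gt_le (hy p) L).trans (le_of_eq ?_))
  rw [Finset.sum_const, Finset.card_univ, nsmul_eq_mul, ENNReal.ofReal_mul (Nat.cast_nonneg _),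
    ENNReal.ofReal_natCast]

open scoped RealInnerProductSpace in
-- The sum is `N` times the quadratic form of `D` at `Bᵀ u`, a vector of norm at most `1`. The bound
-- on `λ₁` enters here and gains the factor `1 / k` in the linear terms.
lemma sum_inner_sq_le {M d k : ℕ} {n : Fin M → ℕ} {α : Fin M → EuclideanSpace ℝ (Fin k)}
    {B : Matrix (Fin d) (Fin k) ℝ} {c₂ : ℝ} (hN : 0 < totalSamples n) (hB : IsOrthonormalMatrix B)
    (hD : eigenvalueDesc (diversityMatrix n α) 1 ≤ c₂ / k) (hc₂ : 0 ≤ c₂)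
    {u : EuclideanSpace ℝ (Fin d)} (hu : ‖u‖ = 1) :
    ∑ i, n i * ⟪u, Matrix.toEuclideanLin B (α i)⟫ ^ 2 ≤ totalSamples n * (c₂ / k) := by
  have h1 := le_eigenvalueDesc_one_mul (isHermitian_diversityMatrix n α)
    (Matrix.toEuclideanLin Bᵀ u)
  have h2 : ‖Matrix.toEuclideanLin Bᵀ u‖ ≤ 1 := by
    rw [← hu]; exact norm_proj_le (inner_toEuclideanLin_left B) hB.left_inverse u
  have h3 := inner_weightedGram hN α (Matrix.toEuclideanLin Bᵀ u)
  rw [weightedGram, inner_toEuclideanLin_sum_vecMulVec] at h3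
  have h4 : ∀ i, ⟪Matrix.toEuclideanLin Bᵀ u, α i⟫ = ⟪u, Matrix.toEuclideanLin B (α i)⟫ :=
    fun i => by rw [real_inner_comm, ← inner_toEuclideanLin_left, real_inner_comm]
  simp only [h4, ← sq] at h3
  rw [h3]
  gcongr
  calc _ ≤ c₂ / k * ‖Matrix.toEuclideanLin Bᵀ u‖ ^ 2 :=
        h1.trans (mul_le_mul_of_nonneg_right hD (sq_nonneg _))
    _ ≤ c₂ / k * 1 := by gcongr; exact pow_le_one₀ (norm_nonneg _) h2
    _ = _ := mul_one _

end SharedRep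

open scoped RealInnerProductSpace in
open SharedRep in
set_option maxHeartbeats 1600000 in
/-- The constants `C₁`, `C₂` depend only on the constants hidden in the `Θ(1)`, `O(1)` of the
assumptions and in `λ_1 = Θ(λ_k) = Θ(1/k)`, which here reads `c₁/k ≤ λ_k ≤ λ_1 ≤ c₂/k`. The
probability is bounded through the (outer) measure of the failure event, so that the selection
`Bhat` of singular vectors need not be measurable. -/
theorem mainTheorem5 (σ2 γ2 : ℝ≥0) (κ c₀ A c₁ c₂ : ℝ) (hc₀ : 0 < c₀) (hc₁ : 0 < c₁) :
    ∃ C₁ > (0 : ℝ), ∃ C₂ > (0 : ℝ),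
      ∀ (M d k : ℕ) (n : Fin M → ℕ), 1 ≤ k → k ≤ d → (∀ i, 2 ≤ n i) →
      ∀ {Ω : Type*} [MeasurableSpace Ω] (μ : Measure Ω) [IsProbabilityMeasure μ]
        (x : (i : Fin M) → Fin (n i) → Ω → EuclideanSpace ℝ (Fin d))
        (y : (i : Fin M) → Fin (n i) → Ω → ℝ)
        (Γ : Fin M → Matrix (Fin d) (Fin d) ℝ) (θ : Fin M → EuclideanSpace ℝ (Fin d))
        (Bstar : Matrix (Fin d) (Fin k) ℝ) (α : Fin M → EuclideanSpace ℝ (Fin k)),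
        SharedRep.IsLinearModel μ x y θ →
        SharedRep.SubGaussianNoise μ x y θ σ2 →
        SharedRep.SubGaussianCovariates μ x Γ γ2 κ c₀ →
        SharedRep.LowDimStructure Γ θ Bstar α →
        (∀ i, ‖α i‖ ≤ A) →
        c₁ / k ≤ SharedRep.eigenvalueDesc (SharedRep.diversityMatrix n α) k →
        SharedRep.eigenvalueDesc (SharedRep.diversityMatrix n α) 1 ≤ c₂ / k →
        ∀ Bhat : Ω → Matrix (Fin d) (Fin k) ℝ,
          (∀ ω, SharedRep.IsEstimate (fun i j => x i j ω) (fun i j => y i j ω) (Bhat ω)) →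
          μ {ω | C₁ * SharedRep.errorRate d k M (SharedRep.totalSamples n) <
              SharedRep.sinThetaDist (Bhat ω) Bstar} ≤
            ENNReal.ofReal (C₂ * ((d : ℝ) + SharedRep.totalSamples n) ^ (-10 : ℤ)) := by
  -- `R` bounds the regression vectors, `w` is the proxy of the responses, `b` the bias constant.
  -- They are fixed before a client exists to force `0 ≤ A`, hence `toNNReal` and `|A|`; the `+ 1`
  -- in `g` covers `γ2 = 0`.
  let R : ℝ≥0 := (κ * A / c₀).toNNReal
  let w : ℝ≥0 := σ2 + R ^ 2 * γ2
  let b : ℝ := Real.exp (8 * w) + Real.exp (2 * γ2)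
  let g : ℝ≥0 := γ2 + 1
  let T : ℝ := 52272 * g + 404 * √(g * (c₂ + b ^ 2)) + b * (2 * |A| + b)
  have hb : 0 < b := by positivity
  have hT : 0 ≤ T := by positivity
  -- The `2` settles the case `N < d k`; `16` is `4` from the subspace bound times `4` from the net.
  -- In the probability, the exponential pays for truncation and `3` for the three tail events.
  refine ⟨2 + 16 * T / c₁, by positivity, 2 * Real.exp (w / 2) + 3, by positivity, ?_⟩
  intro M d k n hk hkd hn Ω _ μ _ x y Γ θ B α hlin hnoise hcov hlow hα hD1 hD2 Bhat hest
  have hk0 : (0 : ℝ) < k := by exact_mod_cast hk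
  have hN := totalSamples_pos_of_eigenvalueDesc_pos hk ((div_pos hc₁ hk0).trans_le hD1)
  set N := totalSamples n with hNdef
  have hM : Nonempty (Fin M) := by
    by_contra hcon
    rw [not_nonempty_iff] at hcon
    simp [hNdef, totalSamples] at hN
  obtain ⟨i₀⟩ := hM
  have hA : 0 ≤ A := (norm_nonneg _).trans (hα i₀)
  have hN2 : 2 ≤ N := (hn i₀).trans
    (Finset.single_le_sum (f := n) (fun i _ => Nat.zero_le _) (Finset.mem_univ i₀))
  have hd : 1 ≤ d := hk.trans hkd
  have hN2' : (2 : ℝ) ≤ N := by exact_mod_cast hN2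
  have hd' : (1 : ℝ) ≤ d := by exact_mod_cast hd
  have hkd' : (k : ℝ) ≤ d := by exact_mod_cast hkd
  set l := Real.log ((d : ℝ) + N) with hl
  have hdN : 0 < (d : ℝ) + N := by positivity
  have hl1 : 1 ≤ l := by
    rw [hl, Real.le_log_iff_exp_le hdN]
    linarith [Real.exp_one_lt_d9]
  rcases lt_or_ge N (d * k) with hsmall | hlarge
  · have h1 := one_le_errorRate (M := M) hN hsmall.le hl1
    have hempty : {ω | (2 + 16 * T / c₁) * errorRate d k M N < sinThetaDist (Bhat ω) B} = ∅ := by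
      refine Set.eq_empty_iff_forall_notMem.2 fun ω hω => ?_
      have hV : IsOrthonormalMatrix (Bhat ω) := (hest ω).elim (fun h => h.1) fun h => h.1
      have h2 := sinThetaDist_le_two hlow.orthonormal hV
      have h3 : 0 ≤ 16 * T / c₁ := by positivity
      have h4 : (2 + 16 * T / c₁) * errorRate d k M N < sinThetaDist (Bhat ω) B := hω
      nlinarith
    rw [hempty, measure_empty]
    exact zero_le
  have hc₂ : 0 ≤ c₂ := by
    have h1 := eigenvalueDesc_last_mul_le (isHermitian_diversityMatrix n α)
      (EuclideanSpace.single ⟨0, hk⟩ 1)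
    have h2 := le_eigenvalueDesc_one_mul (isHermitian_diversityMatrix n α)
      (EuclideanSpace.single ⟨0, hk⟩ 1)
    have h3 := h1.trans h2
    simp only [PiLp.norm_single, norm_one, one_pow, mul_one] at h3
    have h4 : 0 < c₂ / k := (div_pos hc₁ hk0).trans_le (hD1.trans (h3.trans hD2))
    exact (div_pos_iff_of_pos_right hk0).1 h4 |>.le
  -- Now `exp (-L) = (d + N) ^ (-11)`: a union bound over the `N` responses leaves the power `-10`,
  -- and the total bias `N * ε` stays bounded.
  set L : ℝ := 11 * l with hL
  have hL0 : 0 ≤ L := by positivity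
  let z : Fin M → EuclideanSpace ℝ (Fin d) := fun i => Matrix.toEuclideanLin B (α i)
  have hzθ : ∀ i j, Matrix.toEuclideanLin (secondMoment μ (x i j)) (θ i) = z i := fun i j => by
    apply WithLp.ofLp_injective
    simp only [z, Matrix.toLpLin_apply, hcov.covariance i j, hlow.factor i]
  have hz : ∀ i, ‖z i‖ ≤ A := fun i => by
    rw [norm_of_left_inverse (inner_toEuclideanLin_left B) hlow.orthonormal.left_inverse]
    exact hα i
  have hθ : ∀ i, ‖θ i‖ ≤ R := fun i => by
    have h0 : 0 < n i := by linarith [hn i]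
    refine (norm_regression_le (hcov.subGaussian i ⟨0, h0⟩) (hcov.mean_zero i ⟨0, h0⟩) hc₀ ?_ ?_
      ?_).trans (Real.le_coe_toNNReal (κ * A / c₀))
    · rw [hcov.covariance]; exact hcov.condition_number i
    · rw [hcov.covariance]; exact hcov.scale i
    · rw [hzθ]; exact hz i
  let X : ((i : Fin M) × Fin (n i)) → Ω → EuclideanSpace ℝ (Fin d) := fun p ω =>
    truncatedProduct L (y p.1 p.2 ω) (x p.1 p.2 ω)
  have hX : ∀ p, Measurable (X p) := fun p => (measurable_truncatedProduct L).comp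
    ((hlin.measurable_x p.1 p.2).prodMk (hlin.measurable_y p.1 p.2))
  have hind : iIndepFun X μ := hlin.indep.comp (fun _ q => truncatedProduct L q.2 q.1)
    fun _ => measurable_truncatedProduct L
  have hsub : ∀ u : EuclideanSpace ℝ (Fin d), ‖u‖ = 1 → ∀ p,
      HasSubgaussianMGF (fun ω => ⟪u, X p ω⟫ - ∫ ω', ⟪u, X p ω'⟫ ∂μ)
        (2 * L.toNNReal ^ 2 * γ2) μ := fun u hu p =>
    hasSubgaussianMGF_of_abs_le (measurable_const.inner (hX p)).aemeasurable
      (fun ω => by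
        rw [Real.coe_toNNReal _ hL0]
        exact abs_inner_truncatedProduct_le hL0 _ _ _)
      ((hcov.subGaussian p.1 p.2).hasSubgaussianMGF_unit (hcov.mean_zero p.1 p.2) hu)
  set ε : ℝ := Real.exp (-L) * b with hε
  have hε0 : 0 ≤ ε := by positivity
  have hexpL : Real.exp (-L) = (((d : ℝ) + N) ^ 11)⁻¹ := by
    have := exp_neg_mul_log hdN 11
    push_cast at this
    rw [hL, hl, this]
  have hdN1 : 1 ≤ (d : ℝ) + N := by linarith
  have hbias : ∀ u : EuclideanSpace ℝ (Fin d), ‖u‖ = 1 → ∀ p,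
      |∫ ω', ⟪u, X p ω'⟫ ∂μ - ⟪u, z p.1⟫| ≤ ε := fun u hu p => by
    have h1 := truncation_bias_le (hlin.measurable_x p.1 p.2) (hlin.measurable_y p.1 p.2)
      (hcov.subGaussian p.1 p.2) (hcov.mean_zero p.1 p.2) (hnoise.subGaussian p.1 p.2)
      (hnoise.mean_zero p.1 p.2) (hnoise.indep_covariate p.1 p.2) (hθ p.1) hL0 hu
    rw [hzθ] at h1
    exact h1
  have hNε : N * ε ≤ b := by
    rw [hε, hexpL, ← mul_assoc]
    refine mul_le_of_le_one_left hb.le ?_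
    rw [← div_eq_mul_inv, div_le_one (by positivity)]
    calc (N : ℝ) ≤ (d : ℝ) + N := by linarith
      _ ≤ _ := le_self_pow₀ hdN1 (by norm_num)
  have hkε : ε ^ 2 ≤ b ^ 2 / k := by
    rw [hε, hexpL, mul_pow, le_div_iff₀ hk0]
    have h1 : (((d : ℝ) + N) ^ 11)⁻¹ ^ 2 * k ≤ 1 := by
      rw [inv_pow, ← pow_mul, inv_mul_le_iff₀ (by positivity), mul_one]
      calc (k : ℝ) ≤ (d : ℝ) + N := by linarith
        _ ≤ _ := le_self_pow₀ hdN1 (by norm_num)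
    nlinarith [sq_nonneg b]
  -- `726 = 3 * 2 * 11 ^ 2`: half-sample size, centering, truncation level.
  let V : ℝ := 726 * l ^ 2 * g
  have hV : (V.toNNReal : ℝ) = V := Real.coe_toNNReal _ (by positivity)
  have hg0 : (0 : ℝ) < g := by simp only [g, NNReal.coe_add, NNReal.coe_one]; positivity
  have hV0 : 0 < V := by positivity
  have hgγ : (g : ℝ) = γ2 + 1 := by simp [g]
  have hcV : 3 * (2 * L.toNNReal ^ 2 * γ2) ≤ V.toNNReal := by
    rw [← NNReal.coe_le_coe, hV]
    push_cast
    rw [Real.coe_toNNReal _ hL0]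
    simp only [V, hL, hgγ]
    nlinarith [sq_nonneg l]
  let G : ℝ := 2 * N * (c₂ + b ^ 2) / k
  -- `4 d` beats `25 ^ d`, and `10 l` yields the probability `(d + N) ^ (-10)`.
  let τ : ℝ := 4 * d + 10 * l
  have hτ : 0 < τ := by positivity
  have hvar : ∀ u : EuclideanSpace ℝ (Fin d), ‖u‖ = 1 →
      2 * ∑ i, n i * ⟪u, z i⟫ ^ 2 + 2 * (totalSamples n * ε ^ 2) ≤ G := fun u hu => by
    have h1 := sum_inner_sq_le (B := B) hN hlow.orthonormal hD2 hc₂ hu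
    have h2 : (N : ℝ) * ε ^ 2 ≤ N * (b ^ 2 / k) := by gcongr
    have h3 : G = 2 * (N * (c₂ / k)) + 2 * (N * (b ^ 2 / k)) := by simp only [G]; ring
    rw [h3]
    linarith
  let bad : Set Ω := {ω | ¬ ∀ v, ‖Matrix.toEuclideanLin
    (∑ i, (n i : ℝ) • Matrix.vecMulVec
      (vectorMean (Finset.univ.filter fun j : Fin (n i) => (j : ℕ) < n i / 2)
        fun j => X ⟨i, j⟩ ω).ofLp
      (vectorMean (Finset.univ.filter fun j : Fin (n i) => n i / 2 ≤ (j : ℕ))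
        fun j => X ⟨i, j⟩ ω).ofLp -
      ∑ i, (n i : ℝ) • Matrix.vecMulVec (z i).ofLp (z i).ofLp) v‖ ≤
      4 * deviationLevel M N V.toNNReal G τ A ε * ‖v‖}
  have hconc : μ bad ≤ _ := measure_norm_gt_le
    (S := fun i => Finset.univ.filter fun j : Fin (n i) => (j : ℕ) < n i / 2)
    (S' := fun i => Finset.univ.filter fun j : Fin (n i) => n i / 2 ≤ (j : ℕ))
    hX hind hsub (fun i => by linarith [hn i])
    (fun i => by have := hn i; rw [card_filter_lt_half]; omega)
    (fun i => by have := hn i; rw [card_filter_ge_half]; omega)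
    (fun i => by
      rw [Finset.disjoint_filter]
      intro j _ h1 h2
      omega)
    hcV (Real.toNNReal_pos.2 hV0) (G := G) (τ := τ) (by positivity) hτ hA hz hε0 hbias hvar
  have hy : ∀ p : (i : Fin M) × Fin (n i), HasSubgaussianMGF (y p.1 p.2) w μ := fun p =>
    hasSubgaussianMGF_response (hcov.subGaussian p.1 p.2) (hcov.mean_zero p.1 p.2)
      (hnoise.subGaussian p.1 p.2) (hnoise.mean_zero p.1 p.2) (hnoise.indep_covariate p.1 p.2)
      (hθ p.1)
  have htrunc : μ (⋃ p : (i : Fin M) × Fin (n i), {ω | L < |y p.1 p.2 ω|}) ≤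
      ENNReal.ofReal (N * (Real.exp (-L) * (2 * Real.exp (w / 2)))) := by
    have hcard : ((Fintype.card ((i : Fin M) × Fin (n i)) : ℕ) : ℝ) = N := by
      simp [hNdef, totalSamples]
    rw [← hcard]
    exact measure_iUnion_abs_gt_le hy L
  have hdet : {ω | (2 + 16 * T / c₁) * errorRate d k M N < sinThetaDist (Bhat ω) B} ⊆
      (⋃ p : (i : Fin M) × Fin (n i), {ω | L < |y p.1 p.2 ω|}) ∪ bad := fun ω hω => by
    by_contra hcon
    rw [Set.mem_union, not_or] at hcon
    obtain ⟨hcon1, hcon2⟩ := hcon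
    have hyL : ∀ i j, |y i j ω| ≤ L := fun i j => by
      by_contra! h
      exact hcon1 (Set.mem_iUnion.2 ⟨⟨i, j⟩, h⟩)
    have hnorm := not_not.1 hcon2
    have hlev := deviationLevel_le (M := M) (c₂ := c₂) hk hd hlarge hl1 hg0.le hA hb.le hε0 hNε
    have hlev0 : 0 ≤ deviationLevel M N V G τ A ε := by unfold deviationLevel; positivity
    rw [hV] at hnorm
    have hest' := sinThetaDist_le_of_isEstimate hk hc₁ hlow.orthonormal hD1 (hest ω)
      (η := 4 * deviationLevel M N V G τ A ε) (by positivity) (by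
        rw [estimatorMatrix_eq_of_abs_le _ _ hyL]
        exact hnorm)
    have hAabs : |A| = A := abs_of_nonneg hA
    have hT' : deviationLevel M N V G τ A ε ≤ T * (N / k * errorRate d k M N) := by
      simp only [T, hAabs]
      exact hlev
    have hrate : 0 ≤ errorRate d k M N := by unfold errorRate; positivity
    have hfin : sinThetaDist (Bhat ω) B ≤ 16 * T / c₁ * errorRate d k M N := by
      refine hest'.trans ?_
      rw [div_le_iff₀ (by positivity)]
      calc _ ≤ 4 * (4 * (T * (N / k * errorRate d k M N))) := by gcongr
        _ = _ := by field_simp; ring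
    have h4 : (2 + 16 * T / c₁) * errorRate d k M N < sinThetaDist (Bhat ω) B := hω
    linarith
  refine (measure_mono hdet).trans ((measure_union_le _ _).trans
    ((add_le_add htrunc hconc).trans ?_))
  rw [← ENNReal.ofReal_add (by positivity) (by positivity)]
  refine ENNReal.ofReal_le_ofReal ?_
  have hpow : ((d : ℝ) + N) ^ (-10 : ℤ) = (((d : ℝ) + N) ^ 10)⁻¹ := by
    rw [zpow_neg]; norm_cast
  rw [hpow, add_mul]
  refine add_le_add ?_ ?_
  · rw [hexpL]
    have h1 : (N : ℝ) * (((d : ℝ) + N) ^ 11)⁻¹ ≤ (((d : ℝ) + N) ^ 10)⁻¹ := by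
      rw [pow_succ, mul_inv, mul_comm (N : ℝ), mul_assoc]
      refine mul_le_of_le_one_right (by positivity) ?_
      rw [inv_mul_le_iff₀ hdN]
      linarith
    calc _ = (N : ℝ) * (((d : ℝ) + N) ^ 11)⁻¹ * (2 * Real.exp (w / 2)) := by ring
      _ ≤ (((d : ℝ) + N) ^ 10)⁻¹ * (2 * Real.exp (w / 2)) := by gcongr
      _ = _ := by ring
  · have h1 : Real.exp (-τ) = Real.exp (-(4 * d)) * (((d : ℝ) + N) ^ 10)⁻¹ := by
      have := exp_neg_mul_log hdN 10
      push_cast at this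
      rw [← this, ← Real.exp_add]
      congr 1
      simp only [τ, hl]
      ring
    rw [h1]
    have h2 := twentyfive_pow_mul_exp_le d
    calc _ = (25 : ℝ) ^ d * Real.exp (-(4 * d)) * (3 * (((d : ℝ) + N) ^ 10)⁻¹) := by ring
      _ ≤ 1 * (3 * (((d : ℝ) + N) ^ 10)⁻¹) := by gcongr
      _ = _ := one_mul _
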